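/- Let $A,B,K,L\in\mathbb{R}$. The origin is a nilpotent center of the planar differential system $$\dot x = y + Axy + By^2,\qquad \dot y = -x^3 + Kxy^2 + Ly^3$$ if and only if $$AB-3L=0\quad\text{and}\quad AB(A^2-2K)=0.$$ Here a singular point $p$ of a planar system is a center if it has a neighborhood $U$ such that all the orbits of $U\setminus\{p\}$ are (nonconstant) periodic orbits. A center of an analytic system is nilpotent if, after an affine change of variables sending $p$ to the origin and a rescaling of the time by a nonzero constant, the system can be written near the origin as $\dot x=y+F_1(x,y)$, $\dot y=F_2(x,y)$, where $F_1,F_2$ are real analytic near the origin without constant and linear terms. -/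

import Mathlib

open scoped Topology

/-- The singular point `p` of the planar differential system `ż = X z` is a center: it has a
neighborhood `U` such that every orbit of `U \ {p}` is a (nonconstant) periodic orbit. -/
def IsCenter (X : ℝ × ℝ → ℝ × ℝ) (p : ℝ × ℝ) : Prop :=
  X p = 0 ∧
    ∃ U ∈ 𝓝 p, ∀ q ∈ U, q ≠ p →
      ∃ (γ : ℝ → ℝ × ℝ) (T : ℝ), γ 0 = q ∧ (∀ t, HasDerivAt γ (X (γ t)) t) ∧
        (∀ t, γ t ∈ U ∧ γ t ≠ p) ∧
        0 < T ∧ Function.Periodic γ T ∧ ∃ t, γ t ≠ q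

/-- After an affine change of variables `u = Φ z` sending `p` to the origin and a rescaling of
the time by a nonzero constant `c`, the system `ż = X z` takes near the origin the form
`u̇₁ = u₂ + F₁(u₁, u₂)`, `u̇₂ = F₂(u₁, u₂)`, where `F₁`, `F₂` are real analytic at the origin,
without constant and linear terms. -/
def HasNilpotentForm (X : ℝ × ℝ → ℝ × ℝ) (p : ℝ × ℝ) : Prop :=
  ∃ (Φ : (ℝ × ℝ) ≃ᵃ[ℝ] (ℝ × ℝ)) (c : ℝ) (F₁ F₂ : ℝ × ℝ → ℝ),
    Φ p = 0 ∧ c ≠ 0 ∧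
    AnalyticAt ℝ F₁ 0 ∧ F₁ 0 = 0 ∧ fderiv ℝ F₁ 0 = 0 ∧
    AnalyticAt ℝ F₂ 0 ∧ F₂ 0 = 0 ∧ fderiv ℝ F₂ 0 = 0 ∧
    ∀ᶠ u in 𝓝 (0 : ℝ × ℝ), c • Φ.linear (X (Φ.symm u)) = (u.2 + F₁ u, F₂ u)

/-- `p` is a nilpotent center of the planar differential system `ż = X z`. -/
def IsNilpotentCenter (X : ℝ × ℝ → ℝ × ℝ) (p : ℝ × ℝ) : Prop :=
  IsCenter X p ∧ HasNilpotentForm X p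

/-- The vector field of the system
`ẋ = y + A x y + B y²`, `ẏ = -x³ + K x y² + L y³`. -/
def cubicField (A B K L : ℝ) (z : ℝ × ℝ) : ℝ × ℝ :=
  (z.2 + A * z.1 * z.2 + B * z.2 ^ 2, -z.1 ^ 3 + K * z.1 * z.2 ^ 2 + L * z.2 ^ 3)

/-! Give x weight 1 and y weight 2. The leading part of the system is ẋ = y, ẏ = -x³, with
Hamiltonian H = y²/2 + x⁴/4 of weight 4, so near the origin the orbits turn around it. Everything
depends on whether they close up.

Necessity: a function V = H + (higher weight) is built so that its derivative along the system
cancels up to a definite term. That term has weight 8 and coefficient -(AB - 3L)/9. If this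
vanishes, the next one has weight 10 and coefficient -(7/135) AB(A² - 2K). A nonzero coefficient
makes V strictly monotone along orbits, which excludes periodic ones (`not_isCenter_of_weighted`).
In the second case no polynomial V suffices: H² times an angle function and a term x y³|y| are
added.

Sufficiency: if L = AB/3 and AB(A² - 2K) = 0, then either A = L = 0 (symmetry (x, t) → (-x, -t)), or
B = L = 0 (symmetry (y, t) → (-y, -t)), or K = A²/2, where exp(-Ax) is an integrating factor. In
weighted polar coordinates orbits solve a scalar equation dr/dθ, with r the logarithm of the radius.
By `isCenter_cubicField_of_return` it is enough that its solutions return after one turn; this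
follows from the symmetry or from the first integral. -/

/-! ### Scalar ODEs: global existence, periodicity, reflection. -/

/-- A scalar ODE with bounded, globally Lipschitz right-hand side has global solutions. -/
theorem exists_forall_hasDerivAt_of_lipschitz_of_bounded {v : ℝ → ℝ → ℝ} {C : NNReal} {M : ℝ}
    (hv : ∀ t, LipschitzWith C (v t)) (hc : ∀ x, Continuous fun t => v t x)
    (hM : ∀ t x, |v t x| ≤ M) (t₀ x₀ : ℝ) :
    ∃ α : ℝ → ℝ, α t₀ = x₀ ∧ ∀ t, HasDerivAt α (v t (α t)) t := by
  have hM0 : 0 ≤ M := (abs_nonneg _).trans (hM 0 0)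
  -- The global bound M lets the Picard–Lindelöf ball have radius M(n + 1), so no smallness of the
  -- interval is needed.
  have key : ∀ n : ℕ, ∃ α : ℝ → ℝ, α t₀ = x₀ ∧
      ∀ t ∈ Set.Ioo (t₀ - (n + 1)) (t₀ + (n + 1)), HasDerivAt α (v t (α t)) t := by
    intro n
    have hn : (0 : ℝ) < n + 1 := by positivity
    have hP : IsPicardLindelof v (tmin := t₀ - (n + 1)) (tmax := t₀ + (n + 1))
        ⟨t₀, by constructor <;> linarith⟩ x₀ (⟨M, hM0⟩ * ⟨n + 1, hn.le⟩) 0 ⟨M, hM0⟩ C :=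
      { lipschitzOnWith := fun t _ => (hv t).lipschitzOnWith
        continuousOn := fun x _ => (hc x).continuousOn
        norm_le := fun t _ x _ => hM t x
        mul_max_le := by
          simp only [add_sub_cancel_left, sub_sub_cancel, max_self, NNReal.coe_zero, sub_zero]
          exact le_rfl }
    obtain ⟨α, h0, hα⟩ := hP.exists_eq_forall_mem_Icc_hasDerivWithinAt₀
    exact ⟨α, h0, fun t ht => (hα t (Set.Ioo_subset_Icc_self ht)).hasDerivAt
      (Icc_mem_nhds ht.1 ht.2)⟩
  choose α h0 hα using key
  have hcongr : ∀ m n : ℕ, m ≤ n → Set.EqOn (α m) (α n) (Set.Ioo (t₀ - (m + 1)) (t₀ + (m + 1))) := by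
    intro m n hmn
    have hmn' : (m : ℝ) ≤ n := by exact_mod_cast hmn
    have hm : (0 : ℝ) < m + 1 := by positivity
    refine ODE_solution_unique_of_mem_Ioo (s := fun _ => Set.univ) (t₀ := t₀) (v := v) (K := C)
      (fun t _ => (hv t).lipschitzOnWith)
      (by constructor <;> linarith) (fun t ht => ⟨hα m t ht, trivial⟩)
      (fun t ht => ⟨hα n t ⟨by linarith [ht.1], by linarith [ht.2]⟩, trivial⟩)
      ((h0 m).trans (h0 n).symm)
  have hin : ∀ (n : ℕ) (t : ℝ), |t - t₀| < n + 1 → t ∈ Set.Ioo (t₀ - (n + 1)) (t₀ + (n + 1)) := by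
    intro n t h
    rw [abs_lt] at h
    constructor <;> linarith [h.1, h.2]
  have hout : ∀ (n : ℕ) (t : ℝ), t ∈ Set.Ioo (t₀ - (n + 1)) (t₀ + (n + 1)) →
      α ⌈|t - t₀|⌉₊ t = α n t := by
    intro n t ht
    rcases le_total ⌈|t - t₀|⌉₊ n with h | h
    · exact hcongr _ _ h (hin _ _ (by linarith [Nat.le_ceil |t - t₀|]))
    · exact (hcongr _ _ h ht).symm
  -- Glue the solutions: at t use index ⌈|t - t₀|⌉; the extra 1 in the interval length keeps t in
  -- the open interval.
  refine ⟨fun t => α ⌈|t - t₀|⌉₊ t, h0 _, fun t => ?_⟩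
  set n := ⌈|t - t₀|⌉₊
  have ht := hin n t (by linarith [Nat.le_ceil |t - t₀|])
  refine (hα n t ht).congr_of_eventuallyEq ?_
  filter_upwards [isOpen_Ioo.mem_nhds ht] with u hu using hout n u hu

/-- A solution of a periodic ODE which returns to its value after one period is periodic. -/
theorem periodic_of_hasDerivAt_of_eq {v : ℝ → ℝ → ℝ} {C : NNReal} {T : ℝ}
    (hv : ∀ t, LipschitzWith C (v t)) (hT : ∀ t x, v (t + T) x = v t x)
    {α : ℝ → ℝ} (hα : ∀ t, HasDerivAt α (v t (α t)) t) {b : ℝ} (hb : α (b + T) = α b) :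
    Function.Periodic α T := by
  have := ODE_solution_unique_univ (v := v) (s := fun _ => Set.univ) (K := C) (t₀ := b)
    (f := fun t => α (t + T)) (g := α) (fun t => (hv t).lipschitzOnWith)
    (fun t => ⟨by
      have := (hα (t + T)).comp_add_const t T
      rwa [hT] at this, trivial⟩)
    (fun t => ⟨hα t, trivial⟩) hb
  exact fun t => congrFun this t

/-- A solution of an ODE which is reversible with respect to the reflection about `a` is symmetric
about `a`. -/
theorem eq_reflect_of_hasDerivAt {v : ℝ → ℝ → ℝ} {C : NNReal} {a : ℝ}
    (hv : ∀ t, LipschitzWith C (v t)) (ha : ∀ t x, v (2 * a - t) x = -v t x)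
    {α : ℝ → ℝ} (hα : ∀ t, HasDerivAt α (v t (α t)) t) (t : ℝ) : α (2 * a - t) = α t := by
  have := ODE_solution_unique_univ (v := v) (s := fun _ => Set.univ) (K := C) (t₀ := a)
    (f := fun t => α (2 * a - t)) (g := α) (fun t => (hv t).lipschitzOnWith)
    (fun t => ⟨by
      have := (hα (2 * a - t)).comp_const_sub (2 * a) t
      rwa [ha, neg_neg] at this, trivial⟩)
    (fun t => ⟨hα t, trivial⟩) (by ring_nf)
  exact congrFun this t

/-- The reflection about a exchanges a - T/2 and a + T/2, two points one period apart, so the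
solution returns. -/
theorem periodic_of_hasDerivAt_of_reflect {v : ℝ → ℝ → ℝ} {C : NNReal} {a T : ℝ}
    (hv : ∀ t, LipschitzWith C (v t)) (hT : ∀ t x, v (t + T) x = v t x)
    (ha : ∀ t x, v (2 * a - t) x = -v t x)
    {α : ℝ → ℝ} (hα : ∀ t, HasDerivAt α (v t (α t)) t) : Function.Periodic α T := by
  refine periodic_of_hasDerivAt_of_eq hv hT hα (b := a - T / 2) ?_
  rw [← eq_reflect_of_hasDerivAt hv ha hα]
  ring_nf

/-! ### Weighted polar coordinates. -/

theorem isCompact_unitCircle : IsCompact {p : ℝ × ℝ | p.1 ^ 2 + p.2 ^ 2 = 1} := by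
  refine (isCompact_Icc (a := (-1 : ℝ)) (b := 1)).prod
    (isCompact_Icc (a := (-1 : ℝ)) (b := 1)) |>.of_isClosed_subset
    (isClosed_eq (by fun_prop) (by fun_prop)) ?_
  rintro ⟨c, s⟩ h
  simp only [Set.mem_ofPred_eq] at h
  simp only [Set.mem_prod, Set.mem_Icc]
  exact ⟨⟨by nlinarith [sq_nonneg s], by nlinarith [sq_nonneg s]⟩,
    ⟨by nlinarith [sq_nonneg c], by nlinarith [sq_nonneg c]⟩⟩

/-- A continuous function which is positive on `{0} × K`, with `K` compact, stays positive on
`{ρ} × K` for small `ρ`. -/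
theorem IsCompact.exists_forall_abs_le_pos {Y : Type*} [TopologicalSpace Y] {K : Set Y}
    (hK : IsCompact K) {G : ℝ × Y → ℝ} (hG : Continuous G) (h0 : ∀ y ∈ K, 0 < G (0, y)) :
    ∃ r > 0, ∀ ρ, |ρ| ≤ r → ∀ y ∈ K, 0 < G (ρ, y) := by
  have h : ∀ᶠ ρ in 𝓝 (0 : ℝ), ∀ y ∈ K, 0 < G (ρ, y) := by
    refine hK.eventually_forall_of_forall_eventually fun y hy => ?_
    exact hG.continuousAt.eventually (lt_mem_nhds (h0 y hy))
  obtain ⟨ε, hε, h⟩ := Metric.eventually_nhds_iff.1 h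
  refine ⟨ε / 2, by positivity, fun ρ hρ => h ?_⟩
  rw [Real.dist_eq, sub_zero]
  linarith

/-- Quasi-homogeneous polar coordinates of weights `(1, 2)`. -/
theorem exists_weighted_polar {z : ℝ × ℝ} (hz : z ≠ 0) :
    ∃ ρ c s : ℝ, 0 < ρ ∧ c ^ 2 + s ^ 2 = 1 ∧ z = (ρ * c, ρ ^ 2 * s) := by
  obtain ⟨x, y⟩ := z
  -- Since c² + s² = 1 means ρ⁴ = x²ρ² + y², ρ² is the positive root of a quadratic with
  -- discriminant x⁴ + 4y².
  set R := √(x ^ 4 + 4 * y ^ 2)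
  have hnn : 0 ≤ x ^ 4 + 4 * y ^ 2 := by positivity
  have hR : R ^ 2 = x ^ 4 + 4 * y ^ 2 := Real.sq_sqrt hnn
  have hR0 : 0 ≤ R := Real.sqrt_nonneg _
  have hpos : 0 < (x ^ 2 + R) / 2 := by
    by_contra! h
    have hx : x ^ 2 = 0 := by nlinarith [sq_nonneg x]
    have hx' : x = 0 := by simpa using hx
    have hRz : R = 0 := by nlinarith [sq_nonneg x]
    have hy : y = 0 := by
      rw [hRz, hx'] at hR
      have : y ^ 2 = 0 := by linarith
      simpa using this
    exact hz (by simp [hx', hy])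
  set ρ := √((x ^ 2 + R) / 2)
  have hρ : ρ ^ 2 = (x ^ 2 + R) / 2 := Real.sq_sqrt hpos.le
  have hρ0 : 0 < ρ := Real.sqrt_pos.2 hpos
  refine ⟨ρ, x / ρ, y / ρ ^ 2, hρ0, ?_, ?_⟩
  · have : ρ ^ 4 = ρ ^ 2 * x ^ 2 + y ^ 2 := by
      have : ρ ^ 4 = (ρ ^ 2) ^ 2 := by ring
      rw [this, hρ]
      nlinarith
    field_simp
    linarith
  · ext <;> field_simp

theorem exists_weighted_polar_angle {z : ℝ × ℝ} (hz : z ≠ 0) :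
    ∃ ρ θ : ℝ, 0 < ρ ∧ z = (ρ * Real.cos θ, ρ ^ 2 * Real.sin θ) := by
  obtain ⟨ρ, c, s, hρ, h, rfl⟩ := exists_weighted_polar hz
  have hn : ‖(⟨c, s⟩ : ℂ)‖ = 1 := by
    rw [Complex.norm_def, Complex.normSq_mk, ← pow_two, ← pow_two, h, Real.sqrt_one]
  have h0 : (⟨c, s⟩ : ℂ) ≠ 0 := by
    intro h'
    rw [h', norm_zero] at hn
    exact zero_ne_one hn
  refine ⟨ρ, Complex.arg ⟨c, s⟩, hρ, ?_⟩
  rw [Complex.cos_arg h0, Complex.sin_arg, hn]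
  simp

theorem weighted_polar_ne_zero {ρ c s : ℝ} (hρ : 0 < ρ) (h : c ^ 2 + s ^ 2 = 1) :
    ((ρ * c, ρ ^ 2 * s) : ℝ × ℝ) ≠ 0 := by
  intro h'
  simp only [Prod.mk_eq_zero, mul_eq_zero, hρ.ne', false_or, pow_eq_zero_iff, ne_eq,
    OfNat.ofNat_ne_zero, not_false_eq_true] at h'
  simp [h'.1, h'.2] at h

/-- The radius of weighted polar coordinates is controlled by `x ^ 4 + y ^ 2`. -/
theorem weighted_radius_le {ρ c s r : ℝ} (hr : 0 < r) (h : c ^ 2 + s ^ 2 = 1)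
    (hE : (ρ * c) ^ 4 + (ρ ^ 2 * s) ^ 2 ≤ r ^ 4 / 2) : ρ ≤ r := by
  by_contra! hlt
  have h1 : r ^ 4 < ρ ^ 4 := by gcongr
  have h2 : (ρ * c) ^ 4 + (ρ ^ 2 * s) ^ 2 = ρ ^ 4 * (3 / 4 + (c ^ 2 - 1 / 2) ^ 2) := by
    have : s ^ 2 = 1 - c ^ 2 := by linarith
    rw [mul_pow, mul_pow, this]
    ring
  have h3 : 0 ≤ ρ ^ 4 * (c ^ 2 - 1 / 2) ^ 2 := by positivity
  have h4 : 0 < r ^ 4 := by positivity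
  nlinarith

/-! ### Lyapunov functions exclude centers. -/

/-- A singular point with a strict Lyapunov function (in positive or negative time) is not a
center. -/
theorem not_isCenter_of_lyapunov {X : ℝ × ℝ → ℝ × ℝ} {V W E : ℝ × ℝ → ℝ} {m M e σ : ℝ}
    (hm : 0 < m) (he : 0 < e) (hσ : σ ≠ 0) (hE : Continuous E) (hE0 : E 0 = 0)
    (hVl : ∀ z ≠ 0, E z ≤ e → m * E z ≤ V z) (hVu : ∀ z ≠ 0, E z ≤ e → V z ≤ M * E z)
    (hder : ∀ (γ : ℝ → ℝ × ℝ) (t : ℝ), HasDerivAt γ (X (γ t)) t → γ t ≠ 0 →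
      HasDerivAt (fun u => V (γ u)) (W (γ t)) t)
    (hneg : ∀ z ≠ 0, E z ≤ e → σ * W z < 0) : ¬ IsCenter X 0 := by
  rintro ⟨-, U, hU, hper⟩
  have hsmall : ∀ᶠ z in 𝓝 (0 : ℝ × ℝ), z ∈ U ∧ E z < e ∧ M * E z < m * e := by
    refine Filter.Eventually.and hU (Filter.Eventually.and ?_ ?_)
    · exact hE.continuousAt.eventually (gt_mem_nhds (by rwa [hE0]))
    · exact (hE.const_mul M |>.continuousAt).eventually
        (gt_mem_nhds (by simp only [hE0, mul_zero]; positivity))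
  obtain ⟨q, ⟨hqU, hqe, hqM⟩, hq0⟩ :=
    ((hsmall.filter_mono nhdsWithin_le_nhds).and self_mem_nhdsWithin :
      ∀ᶠ z in 𝓝[≠] (0 : ℝ × ℝ), _).exists
  obtain ⟨γ, T, h0, hγ, hγU, hT, hTper, -⟩ := hper q hqU hq0
  -- Rescaling time by σ makes V decrease whatever the sign of σ.
  have hδ : ∀ t, HasDerivAt (fun u => V (γ (σ * u))) (σ * W (γ (σ * t))) t := by
    intro t
    have h1 := hder γ (σ * t) (hγ _) (hγU _).2
    have h2 : HasDerivAt (fun u => σ * u) σ t := by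
      simpa using (hasDerivAt_id t).const_mul σ
    have := HasDerivAt.comp t h1 h2
    rwa [mul_comm] at this
  have hγc : Continuous γ := continuous_iff_continuousAt.2 fun t => (hγ t).continuousAt
  have hEc : Continuous fun t => E (γ (σ * t)) := by fun_prop
  have hVc : Continuous fun t => V (γ (σ * t)) :=
    continuous_iff_continuousAt.2 fun t => (hδ t).continuousAt
  have hanti : ∀ t₁ : ℝ, 0 < t₁ → (∀ t ∈ Set.Ico 0 t₁, E (γ (σ * t)) < e) →
      V (γ (σ * t₁)) < V q := by
    intro t₁ ht₁ hlt
    have := strictAntiOn_of_deriv_neg (convex_Icc 0 t₁) hVc.continuousOn (fun t ht => by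
      rw [interior_Icc] at ht
      rw [(hδ t).deriv]
      exact hneg _ (hγU _).2 (hlt t ⟨ht.1.le, ht.2⟩).le) (Set.left_mem_Icc.2 ht₁.le)
      (Set.right_mem_Icc.2 ht₁.le) ht₁
    simpa [h0] using this
  -- Barrier: at a first exit time, m e ≤ V < V q ≤ M E q < m e, which is absurd. So V decreases for
  -- all time, contradicting periodicity.
  have hstay : ∀ t ≥ 0, E (γ (σ * t)) < e := by
    by_contra! hcon
    obtain ⟨t₂, ht₂, hge⟩ := hcon
    set S := Set.Ici (0 : ℝ) ∩ {t | e ≤ E (γ (σ * t))}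
    have hSc : IsClosed S := isClosed_Ici.inter (isClosed_le continuous_const hEc)
    have hSb : BddBelow S := ⟨0, fun t ht => ht.1⟩
    have hmem : sInf S ∈ S := hSc.csInf_mem ⟨t₂, ht₂, hge⟩ hSb
    have hpos : 0 < sInf S := by
      refine lt_of_le_of_ne hmem.1 fun h => ?_
      have := hmem.2
      simp only [Set.mem_ofPred_eq, ← h, mul_zero, h0] at this
      linarith
    have hbefore : ∀ t ∈ Set.Ico 0 (sInf S), E (γ (σ * t)) < e := by
      intro t ht
      by_contra! h
      exact absurd (csInf_le hSb ⟨ht.1, h⟩) (not_le.2 ht.2)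
    have hle : E (γ (σ * sInf S)) ≤ e := by
      have : closure (Set.Ico 0 (sInf S)) ⊆ {t | E (γ (σ * t)) ≤ e} :=
        closure_minimal (fun t ht => (hbefore t ht).le) (isClosed_le hEc continuous_const)
      rw [closure_Ico hpos.ne] at this
      exact this (Set.right_mem_Icc.2 hpos.le)
    have h1 := hanti _ hpos hbefore
    have h2 := hVl _ (hγU (σ * sInf S)).2 hle
    have h3 := hVu q hq0 hqe.le
    have h4 : m * e ≤ m * E (γ (σ * sInf S)) := by
      gcongr
      exact hmem.2
    linarith
  have hfin := hanti (T / |σ|) (by positivity) fun t ht => hstay t ht.1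
  rcases lt_or_gt_of_ne hσ with h | h
  · rw [abs_of_neg h, show σ * (T / -σ) = 0 - T by field_simp; ring, hTper.sub_eq, h0] at hfin
    exact lt_irrefl _ hfin
  · rw [abs_of_pos h, show σ * (T / σ) = 0 + T by field_simp; ring, hTper, h0] at hfin
    exact lt_irrefl _ hfin

/-- A function `V` whose leading quasi-homogeneous part is `y ^ 2 / 2 + x ^ 4 / 4` and whose
derivative `W` along the vector field has a definite leading quasi-homogeneous part `σ P` prevents a
center. The higher order terms may depend on a bounded function `φ`. -/
theorem not_isCenter_of_weighted {X : ℝ × ℝ → ℝ × ℝ} {V W φ : ℝ × ℝ → ℝ} {C σ : ℝ} {n : ℕ}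
    {P : ℝ × ℝ → ℝ} {R S : ℝ × (ℝ × ℝ) × ℝ → ℝ}
    (hσ : σ ≠ 0) (hφ : ∀ z, |φ z| ≤ C) (hP : Continuous P) (hR : Continuous R)
    (hS : Continuous S) (hPpos : ∀ c s : ℝ, c ^ 2 + s ^ 2 = 1 → 0 < P (c, s))
    (hV : ∀ ρ c s : ℝ, 0 < ρ → V (ρ * c, ρ ^ 2 * s) =
      ρ ^ 4 * (s ^ 2 / 2 + c ^ 4 / 4 + ρ * R (ρ, (c, s), φ (ρ * c, ρ ^ 2 * s))))
    (hW : ∀ ρ c s : ℝ, 0 < ρ → W (ρ * c, ρ ^ 2 * s) =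
      ρ ^ n * (σ * P (c, s) + ρ * S (ρ, (c, s), φ (ρ * c, ρ ^ 2 * s))))
    (hder : ∀ (γ : ℝ → ℝ × ℝ) (t : ℝ), HasDerivAt γ (X (γ t)) t → γ t ≠ 0 →
      HasDerivAt (fun u => V (γ u)) (W (γ t)) t) : ¬ IsCenter X 0 := by
  -- `φ` need not be continuous, so its value is treated as a free parameter in [-C, C].
  have hK : IsCompact ({p : ℝ × ℝ | p.1 ^ 2 + p.2 ^ 2 = 1} ×ˢ Set.Icc (-C) C) :=
    isCompact_unitCircle.prod isCompact_Icc
  have hpos : ∀ c s : ℝ, c ^ 2 + s ^ 2 = 1 → 0 < c ^ 4 + s ^ 2 := by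
    intro c s h
    nlinarith [sq_nonneg (c ^ 2 - 1 / 2)]
  obtain ⟨r₁, hr₁, h₁⟩ := hK.exists_forall_abs_le_pos
    (G := fun p => (p.2.1.2 ^ 2 / 2 + p.2.1.1 ^ 4 / 4 + p.1 * R p)
      - 1 / 8 * (p.2.1.1 ^ 4 + p.2.1.2 ^ 2)) (by fun_prop) (by
      rintro ⟨⟨c, s⟩, f⟩ ⟨h, -⟩
      have := hpos c s h
      dsimp only
      nlinarith [sq_nonneg s])
  obtain ⟨r₂, hr₂, h₂⟩ := hK.exists_forall_abs_le_pos
    (G := fun p => (p.2.1.1 ^ 4 + p.2.1.2 ^ 2) -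
      (p.2.1.2 ^ 2 / 2 + p.2.1.1 ^ 4 / 4 + p.1 * R p)) (by fun_prop) (by
      rintro ⟨⟨c, s⟩, f⟩ ⟨h, -⟩
      have := hpos c s h
      have : 0 ≤ c ^ 4 := by positivity
      dsimp only
      nlinarith [sq_nonneg s])
  obtain ⟨r₃, hr₃, h₃⟩ := hK.exists_forall_abs_le_pos
    (G := fun p => σ * (σ * P p.2.1 + p.1 * S p)) (by fun_prop) (by
      rintro ⟨⟨c, s⟩, f⟩ ⟨h, -⟩
      have := hPpos c s h
      have : 0 < σ ^ 2 := by positivity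
      dsimp only
      rw [zero_mul, add_zero, ← mul_assoc, ← pow_two]
      positivity)
  set r := min r₁ (min r₂ r₃)
  have hr : 0 < r := by positivity
  have hkey : ∀ z : ℝ × ℝ, z ≠ 0 → z.1 ^ 4 + z.2 ^ 2 ≤ r ^ 4 / 2 → ∃ ρ c s, 0 < ρ ∧
      |ρ| ≤ r₁ ∧ |ρ| ≤ r₂ ∧ |ρ| ≤ r₃ ∧ c ^ 2 + s ^ 2 = 1 ∧ z = (ρ * c, ρ ^ 2 * s) := by
    intro z hz hE
    obtain ⟨ρ, c, s, hρ, h, rfl⟩ := exists_weighted_polar hz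
    have := weighted_radius_le hr h hE
    rw [← abs_of_pos hρ] at this
    exact ⟨ρ, c, s, hρ, this.trans (min_le_left _ _),
      this.trans ((min_le_right _ _).trans (min_le_left _ _)),
      this.trans ((min_le_right _ _).trans (min_le_right _ _)), h, rfl⟩
  have hmem : ∀ ρ c s : ℝ, c ^ 2 + s ^ 2 = 1 → ((c, s), φ (ρ * c, ρ ^ 2 * s)) ∈
      {p : ℝ × ℝ | p.1 ^ 2 + p.2 ^ 2 = 1} ×ˢ Set.Icc (-C) C :=
    fun ρ c s h => ⟨h, abs_le.1 (hφ _)⟩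
  -- The leading part of V lies between E/4 and E/2; the constants 1/8 and 1 leave room for the
  -- remainder.
  refine not_isCenter_of_lyapunov (V := V) (W := W) (E := fun z => z.1 ^ 4 + z.2 ^ 2)
    (m := 1 / 8) (M := 1) (e := r ^ 4 / 2) (σ := -σ) (by norm_num) (by positivity)
    (neg_ne_zero.2 hσ) (by fun_prop) (by simp) ?_ ?_ hder ?_
  · intro z hz hE
    obtain ⟨ρ, c, s, hρ, hρ₁, -, -, h, rfl⟩ := hkey z hz hE
    have := h₁ ρ hρ₁ _ (hmem ρ c s h)
    rw [hV ρ c s hρ]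
    have h4 : 0 < ρ ^ 4 := by positivity
    dsimp only at this ⊢
    nlinarith [mul_pos h4 this]
  · intro z hz hE
    obtain ⟨ρ, c, s, hρ, -, hρ₁, -, h, rfl⟩ := hkey z hz hE
    have := h₂ ρ hρ₁ _ (hmem ρ c s h)
    rw [hV ρ c s hρ]
    have h4 : 0 < ρ ^ 4 := by positivity
    dsimp only at this ⊢
    nlinarith [mul_pos h4 this]
  · intro z hz hE
    obtain ⟨ρ, c, s, hρ, -, -, hρ₁, h, rfl⟩ := hkey z hz hE
    have := h₃ ρ hρ₁ _ (hmem ρ c s h)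
    rw [hW ρ c s hρ]
    have h4 : 0 < ρ ^ n := by positivity
    dsimp only at this ⊢
    nlinarith [mul_pos h4 this]

/-! ### First focal value. -/

/-- The polynomial `∑ c x ^ a y ^ b` given by the list of its terms `(c, a, b)`. -/
def evalTerms (l : List (ℝ × ℕ × ℕ)) (x y : ℝ) : ℝ :=
  (l.map fun m => m.1 * x ^ m.2.1 * y ^ m.2.2).sum

/-- The derivative of `evalTerms l` at `(x, y)` in the direction `(x', y')`. -/
def derivTerms (l : List (ℝ × ℕ × ℕ)) (x y x' y' : ℝ) : ℝ :=
  (l.map fun m => m.1 * (m.2.1 * x ^ (m.2.1 - 1) * x') * y ^ m.2.2 +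
    m.1 * x ^ m.2.1 * (m.2.2 * y ^ (m.2.2 - 1) * y')).sum

theorem hasDerivAt_evalTerms (l : List (ℝ × ℕ × ℕ)) {x y : ℝ → ℝ} {x' y' t : ℝ}
    (hx : HasDerivAt x x' t) (hy : HasDerivAt y y' t) :
    HasDerivAt (fun u => evalTerms l (x u) (y u)) (derivTerms l (x t) (y t) x' y') t := by
  induction l with
  | nil => simpa [evalTerms, derivTerms] using hasDerivAt_const t (0 : ℝ)
  | cons m l ih =>
    simp only [evalTerms, derivTerms, List.map_cons, List.sum_cons] at ih ⊢
    exact (((hx.pow m.2.1).const_mul m.1).mul (hy.pow m.2.2)).add ih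

theorem hasDerivAt_fst_snd {γ : ℝ → ℝ × ℝ} {v : ℝ × ℝ} {t : ℝ} (h : HasDerivAt γ v t) :
    HasDerivAt (fun u => (γ u).1) v.1 t ∧ HasDerivAt (fun u => (γ u).2) v.2 t :=
  ⟨(ContinuousLinearMap.fst ℝ ℝ ℝ).hasFDerivAt.comp_hasDerivAt t h,
    (ContinuousLinearMap.snd ℝ ℝ ℝ).hasFDerivAt.comp_hasDerivAt t h⟩

/-- Lyapunov function for the first focal value. -/
noncomputable def lyapunovTerms₁ (A B K L : ℝ) : List (ℝ × ℕ × ℕ) :=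
  [(1 / 2, 0, 2), (1 / 4, 4, 0), (-1 / 5 * A, 5, 0), (1 / 3 * B, 0, 3), (-1 / 2 * K, 2, 2),
   (1 / 6 * A ^ 2 - 1 / 6 * K, 6, 0), (-1 / 9 * A * B - 2 / 3 * L, 1, 3), (1 / 3 * A * K, 3, 2),
   (1 / 9 * A * B - 1 / 3 * L, 5, 1), (-1 / 7 * A ^ 3 + 5 / 21 * A * K, 7, 0)]

/-- Modulo derivatives of x y³ and x⁵y along ẋ = y, ẏ = -x³, one has y⁴ ~ 3x⁴y² and x⁸ ~ 5x⁴y². The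
weight 8 obstruction is thus one number, 3L - AB times x⁴y²; spreading it over x⁸ + x⁴y² + y⁴ ~
9x⁴y² gives the definite form `P` and the factor 1/9. -/
theorem eq_of_isCenter_cubicField {A B K L : ℝ} (h : IsCenter (cubicField A B K L) 0) :
    A * B - 3 * L = 0 := by
  by_contra hne
  refine not_isCenter_of_weighted
    (V := fun z => evalTerms (lyapunovTerms₁ A B K L) z.1 z.2)
    (W := fun z => derivTerms (lyapunovTerms₁ A B K L) z.1 z.2
      (cubicField A B K L z).1 (cubicField A B K L z).2)
    (φ := fun _ => 0) (C := 0) (σ := -1 / 9 * A * B + 1 / 3 * L) (n := 8)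
    (P := fun p => p.1 ^ 8 + p.1 ^ 4 * p.2 ^ 2 + p.2 ^ 4)
    (R := fun p =>
      (-1 / 5 * A) * p.2.1.1 ^ 5 + (1 / 3 * B) * p.1 * p.2.1.2 ^ 3 +
      (-1 / 2 * K) * p.1 * p.2.1.1 ^ 2 * p.2.1.2 ^ 2 +
      (1 / 6 * A ^ 2 - 1 / 6 * K) * p.1 * p.2.1.1 ^ 6 +
      (-1 / 9 * A * B - 2 / 3 * L) * p.1 ^ 2 * p.2.1.1 * p.2.1.2 ^ 3 +
      (1 / 3 * A * K) * p.1 ^ 2 * p.2.1.1 ^ 3 * p.2.1.2 ^ 2 +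
      (1 / 9 * A * B - 1 / 3 * L) * p.1 ^ 2 * p.2.1.1 ^ 5 * p.2.1.2 +
      (-1 / 7 * A ^ 3 + 5 / 21 * A * K) * p.1 ^ 2 * p.2.1.1 ^ 7)
    (S := fun p =>
      (-1 / 9 * A ^ 2 * B - 2 / 3 * A * L) * p.2.1.1 * p.2.1.2 ^ 4 +
      (A ^ 2 * K - K ^ 2) * p.2.1.1 ^ 3 * p.2.1.2 ^ 3 +
      (14 / 9 * A ^ 2 * B - 5 / 3 * A * L - B * K) * p.2.1.1 ^ 5 * p.2.1.2 ^ 2 +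
      (-A ^ 4 + 5 / 3 * A ^ 2 * K) * p.2.1.1 ^ 7 * p.2.1.2 +
      (-1 / 9 * A * B ^ 2 + 1 / 3 * B * L) * p.1 * p.2.1.2 ^ 5 +
      (2 / 3 * A * B * K - 3 * K * L) * p.1 * p.2.1.1 ^ 2 * p.2.1.2 ^ 4 +
      (5 / 9 * A * B ^ 2 + 2 / 3 * A * K ^ 2 - 5 / 3 * B * L) * p.1 * p.2.1.1 ^ 4 * p.2.1.2 ^ 3 +
      (-A ^ 3 * B + 16 / 9 * A * B * K - 1 / 3 * K * L) * p.1 * p.2.1.1 ^ 6 * p.2.1.2 ^ 2 +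
      (-1 / 3 * A * B * L - 2 * L ^ 2) * p.1 ^ 2 * p.2.1.1 * p.2.1.2 ^ 5 +
      (2 / 3 * A * K * L) * p.1 ^ 2 * p.2.1.1 ^ 3 * p.2.1.2 ^ 4 +
      (1 / 9 * A * B * L - 1 / 3 * L ^ 2) * p.1 ^ 2 * p.2.1.1 ^ 5 * p.2.1.2 ^ 3)
    ?_ (by simp) (by fun_prop) (by fun_prop) (by fun_prop) ?_ ?_ ?_ ?_ h
  · intro h0
    exact hne (by linarith)
  · intro c s hcs
    dsimp only
    by_cases hc : c = 0
    · have hs : s ^ 2 = 1 := by simpa [hc] using hcs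
      have : s ^ 4 = 1 := by rw [show s ^ 4 = (s ^ 2) ^ 2 by ring, hs, one_pow]
      simp [hc, this]
    · positivity
  · intro ρ c s _
    simp only [evalTerms, lyapunovTerms₁, List.map_cons, List.map_nil, List.sum_cons,
      List.sum_nil]
    ring
  · intro ρ c s _
    simp only [derivTerms, lyapunovTerms₁, List.map_cons, List.map_nil, List.sum_cons,
      List.sum_nil, cubicField]
    push_cast
    ring
  · intro γ t hγ _
    obtain ⟨hx, hy⟩ := hasDerivAt_fst_snd hγ
    exact hasDerivAt_evalTerms _ hx hy

/-! ### Second focal value. -/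

/-- A smooth branch, away from the origin, of the angle of the curve `(x ^ 2, √2 y)`. -/
noncomputable def parabolicAngle (z : ℝ × ℝ) : ℝ :=
  -Complex.arg (((z.1 ^ 2 : ℝ) : ℂ) + ((√2 * z.2 : ℝ) : ℂ) * Complex.I) / √2

theorem abs_parabolicAngle_le (z : ℝ × ℝ) : |parabolicAngle z| ≤ Real.pi := by
  have h2 : (1 : ℝ) ≤ √2 := by
    rw [Real.one_le_sqrt]
    norm_num
  rw [parabolicAngle, abs_div, abs_neg, abs_of_nonneg (Real.sqrt_nonneg 2)]
  exact (div_le_self (abs_nonneg _) h2).trans (Complex.abs_arg_le_pi _)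

/-- For v = (y, -x³) the quotient is just x: the angle is a primitive of x along the leading flow.
Off the origin, (x², √2 y) avoids the cut of the argument because x² ≥ 0. -/
theorem hasDerivAt_parabolicAngle {γ : ℝ → ℝ × ℝ} {v : ℝ × ℝ} {t : ℝ} (h : HasDerivAt γ v t)
    (h0 : γ t ≠ 0) :
    HasDerivAt (fun u => parabolicAngle (γ u)) ((γ t).1 * (2 * (γ t).2 * v.1 - (γ t).1 * v.2) /
      ((γ t).1 ^ 4 + 2 * (γ t).2 ^ 2)) t := by
  obtain ⟨hx, hy⟩ := hasDerivAt_fst_snd h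
  have h2 : √2 ^ 2 = 2 := Real.sq_sqrt (by norm_num)
  have h2' : √2 ≠ 0 := by positivity
  have hw := (hx.pow 2).ofReal_comp.add
    (((hy.const_mul (√2)).ofReal_comp).mul_const Complex.I)
  have hpos : 0 < (γ t).1 ^ 4 + 2 * (γ t).2 ^ 2 := by
    by_cases hx0 : (γ t).1 = 0
    · have : (γ t).2 ≠ 0 := fun h' => h0 (Prod.ext hx0 h')
      positivity
    · positivity
  have hslit : (((γ t).1 ^ 2 : ℝ) : ℂ) + ((√2 * (γ t).2 : ℝ) : ℂ) * Complex.I ∈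
      Complex.slitPlane := by
    rw [Complex.mem_slitPlane_iff]
    by_cases hx0 : (γ t).1 = 0
    · right
      have : (γ t).2 ≠ 0 := fun h' => h0 (Prod.ext hx0 h')
      rw [Complex.add_im, Complex.ofReal_im, Complex.im_ofReal_mul, Complex.I_im, mul_one, zero_add]
      exact mul_ne_zero h2' this
    · left
      have : 0 < (γ t).1 ^ 2 := by positivity
      rwa [Complex.add_re, Complex.ofReal_re, Complex.re_ofReal_mul, Complex.I_re, mul_zero,
        add_zero]
  have hl : HasDerivAt (fun u => Complex.arg ((((γ u).1 ^ 2 : ℝ) : ℂ) +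
      ((√2 * (γ u).2 : ℝ) : ℂ) * Complex.I)) _ t :=
    (Complex.imCLM.hasFDerivAt.comp_hasDerivAt t (hw.clog_real hslit)).congr_of_eventuallyEq
      (Filter.Eventually.of_forall fun u => (Complex.log_im _).symm)
  refine ((hl.neg).div_const (√2)).congr_deriv ?_
  have h3 : Complex.normSq (((γ t).1 ^ 2 : ℝ) + ((√2 * (γ t).2 : ℝ) : ℂ) * Complex.I) =
      (γ t).1 ^ 4 + 2 * (γ t).2 ^ 2 := by
    rw [Complex.normSq_add_mul_I, mul_pow, h2]
    ring
  rw [Complex.imCLM_apply, Complex.div_im]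
  simp only [Pi.add_apply, Pi.pow_apply, h3, Complex.add_re, Complex.add_im, Complex.ofReal_re,
    Complex.ofReal_im, Complex.re_ofReal_mul, Complex.im_ofReal_mul, Complex.I_re, Complex.I_im,
    mul_zero, mul_one, add_zero, zero_add]
  field_simp
  push_cast
  ring

theorem hasDerivAt_pow_three_mul_abs (y : ℝ) :
    HasDerivAt (fun u : ℝ => u ^ 3 * |u|) (4 * y ^ 2 * |y|) y := by
  rcases lt_trichotomy y 0 with h | rfl | h
  · have := (hasDerivAt_pow 3 y).mul (hasDerivAt_abs_neg h)
    refine this.congr_deriv ?_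
    rw [abs_of_neg h]
    push_cast
    ring
  · have : (fun u : ℝ => u ^ 3 * |u|) =o[𝓝 0] fun u => u := by
      have h1 : Filter.Tendsto (fun u : ℝ => u ^ 2 * |u|) (𝓝 0) (𝓝 0) :=
        Continuous.tendsto' (by fun_prop) _ _ (by simp)
      have := (Asymptotics.isLittleO_one_iff ℝ).2 h1 |>.mul_isBigO
        (Asymptotics.isBigO_refl (fun u : ℝ => u) (𝓝 0))
      refine (this.congr_left fun u => ?_).congr_right fun u => one_mul u
      ring
    rw [hasDerivAt_iff_isLittleO]
    simpa using this
  · have := (hasDerivAt_pow 3 y).mul (hasDerivAt_abs_pos h)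
    refine this.congr_deriv ?_
    rw [abs_of_pos h]
    push_cast
    ring

/-- The polynomial part of the Lyapunov function for the second focal value. -/
noncomputable def lyapunovTerms₂ (A B K : ℝ) : List (ℝ × ℕ × ℕ) :=
  [(1 / 2, 0, 2), (1 / 4, 4, 0), (-1 / 5 * A, 5, 0), (1 / 3 * B, 0, 3), (-1 / 2 * K, 2, 2),
   (1 / 6 * A ^ 2 - 1 / 6 * K, 6, 0), (-1 / 3 * A * B, 1, 3), (1 / 3 * A * K, 3, 2),
   (-1 / 7 * A ^ 3 + 5 / 21 * A * K, 7, 0), (11 / 48 * A ^ 2 * B - 1 / 8 * B * K, 2, 3),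
   (-1 / 4 * A ^ 2 * K + 1 / 4 * K ^ 2, 4, 2), (-1 / 32 * A ^ 2 * B + 1 / 16 * B * K, 6, 1),
   (1 / 8 * A ^ 4 - 13 / 48 * A ^ 2 * K + 1 / 16 * K ^ 2, 8, 0),
   (-52 / 405 * A ^ 3 * B + 59 / 405 * A * B * K, 3, 3),
   (1 / 5 * A ^ 3 * K - 1 / 3 * A * K ^ 2, 5, 2),
   (11 / 108 * A ^ 3 * B - 11 / 54 * A * B * K, 7, 1),
   (-1 / 9 * A ^ 5 + 77 / 270 * A ^ 3 * K - 7 / 54 * A * K ^ 2, 9, 0)]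

/-- The coefficients of the transcendental part of the Lyapunov function. -/
noncomputable def angleTerms (A B K : ℝ) : List (ℝ × ℕ × ℕ) :=
  [(-1 / 4 * B * (A ^ 2 - 2 * K), 0, 2), (-1 / 8 * B * (A ^ 2 - 2 * K), 4, 0),
    (1 / 5 * A * B * (A ^ 2 - 2 * K), 5, 0)]

/-- Lyapunov function for the second focal value. -/
noncomputable def lyapunov₂ (A B K : ℝ) (z : ℝ × ℝ) : ℝ :=
  evalTerms (lyapunovTerms₂ A B K) z.1 z.2 +
    ((z.2 ^ 2 / 2 + z.1 ^ 4 / 4) * evalTerms (angleTerms A B K) z.1 z.2 * parabolicAngle z +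
      -7 / 1080 * (A * B * (A ^ 2 - 2 * K)) * (z.1 * (z.2 ^ 3 * |z.2|)))

/-- The derivative of `lyapunov₂ A B K` at `z` in the direction `v`. -/
noncomputable def lyapunovDeriv₂ (A B K : ℝ) (z v : ℝ × ℝ) : ℝ :=
  derivTerms (lyapunovTerms₂ A B K) z.1 z.2 v.1 v.2 +
    (((z.2 * v.2 + z.1 ^ 3 * v.1) * evalTerms (angleTerms A B K) z.1 z.2 +
        (z.2 ^ 2 / 2 + z.1 ^ 4 / 4) * derivTerms (angleTerms A B K) z.1 z.2 v.1 v.2) *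
          parabolicAngle z +
      evalTerms (angleTerms A B K) z.1 z.2 * (z.1 * (2 * z.2 * v.1 - z.1 * v.2)) / 4 +
      -7 / 1080 * (A * B * (A ^ 2 - 2 * K)) *
        (v.1 * (z.2 ^ 3 * |z.2|) + z.1 * (4 * z.2 ^ 2 * |z.2| * v.2)))

theorem hasDerivAt_lyapunov₂ (A B K : ℝ) {γ : ℝ → ℝ × ℝ} {v : ℝ × ℝ} {t : ℝ}
    (hγ : HasDerivAt γ v t) (h0 : γ t ≠ 0) :
    HasDerivAt (fun u => lyapunov₂ A B K (γ u)) (lyapunovDeriv₂ A B K (γ t) v) t := by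
  obtain ⟨hx, hy⟩ := hasDerivAt_fst_snd hγ
  have hpos : 0 < (γ t).1 ^ 4 + 2 * (γ t).2 ^ 2 := by
    by_cases hx0 : (γ t).1 = 0
    · have : (γ t).2 ≠ 0 := fun h' => h0 (Prod.ext hx0 h')
      positivity
    · positivity
  have h1 := hasDerivAt_evalTerms (lyapunovTerms₂ A B K) hx hy
  have h2 : HasDerivAt (fun u => (γ u).2 ^ 2 / 2 + (γ u).1 ^ 4 / 4)
      ((γ t).2 * v.2 + (γ t).1 ^ 3 * v.1) t := by
    refine (((hy.pow 2).div_const 2).add ((hx.pow 4).div_const 4)).congr_deriv ?_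
    push_cast
    ring
  have h3 := hasDerivAt_evalTerms (angleTerms A B K) hx hy
  have h4 := hasDerivAt_parabolicAngle hγ h0
  have h5 : HasDerivAt (fun u => (γ u).2 ^ 3 * |(γ u).2|) (4 * (γ t).2 ^ 2 * |(γ t).2| * v.2) t :=
    HasDerivAt.comp t (h₂ := fun u : ℝ => u ^ 3 * |u|) (h := fun u => (γ u).2)
      (hasDerivAt_pow_three_mul_abs (γ t).2) hy
  refine (h1.add (((h2.mul h3).mul h4).add ((hx.mul h5).const_mul
    (-7 / 1080 * (A * B * (A ^ 2 - 2 * K)))))).congr_deriv ?_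
  -- The angle is always multiplied by H, a quarter of the denominator of its derivative, so the
  -- quotient disappears.
  have h6 : (γ t).2 ^ 2 / 2 + (γ t).1 ^ 4 / 4 = ((γ t).1 ^ 4 + 2 * (γ t).2 ^ 2) / 4 := by
    ring
  have h7 : ∀ a : ℝ, ((γ t).1 ^ 4 + 2 * (γ t).2 ^ 2) / 4 * a * ((γ t).1 *
      (2 * (γ t).2 * v.1 - (γ t).1 * v.2) / ((γ t).1 ^ 4 + 2 * (γ t).2 ^ 2)) =
      a * ((γ t).1 * (2 * (γ t).2 * v.1 - (γ t).1 * v.2)) / 4 := by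
    intro a
    field_simp
  rw [lyapunovDeriv₂, ← h7, ← h6]
  rfl

theorem lyapunov₂_weighted (A B K ρ c s : ℝ) :
    lyapunov₂ A B K (ρ * c, ρ ^ 2 * s) = ρ ^ 4 * (s ^ 2 / 2 + c ^ 4 / 4 + ρ * (
      (-1 / 5 * A) * c ^ 5 + (1 / 3 * B) * ρ * s ^ 3 + (-1 / 2 * K) * ρ * c ^ 2 * s ^ 2 +
      (1 / 6 * A ^ 2 - 1 / 6 * K) * ρ * c ^ 6 + (-1 / 3 * A * B) * ρ ^ 2 * c * s ^ 3 +
      (1 / 3 * A * K) * ρ ^ 2 * c ^ 3 * s ^ 2 + (-1 / 7 * A ^ 3 + 5 / 21 * A * K) * ρ ^ 2 * c ^ 7 +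
      (11 / 48 * A ^ 2 * B - 1 / 8 * B * K) * ρ ^ 3 * c ^ 2 * s ^ 3 +
      (-1 / 4 * A ^ 2 * K + 1 / 4 * K ^ 2) * ρ ^ 3 * c ^ 4 * s ^ 2 +
      (-1 / 32 * A ^ 2 * B + 1 / 16 * B * K) * ρ ^ 3 * c ^ 6 * s +
      (1 / 8 * A ^ 4 - 13 / 48 * A ^ 2 * K + 1 / 16 * K ^ 2) * ρ ^ 3 * c ^ 8 +
      (-52 / 405 * A ^ 3 * B + 59 / 405 * A * B * K) * ρ ^ 4 * c ^ 3 * s ^ 3 +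
      (1 / 5 * A ^ 3 * K - 1 / 3 * A * K ^ 2) * ρ ^ 4 * c ^ 5 * s ^ 2 +
      (11 / 108 * A ^ 3 * B - 11 / 54 * A * B * K) * ρ ^ 4 * c ^ 7 * s +
      (-1 / 9 * A ^ 5 + 77 / 270 * A ^ 3 * K - 7 / 54 * A * K ^ 2) * ρ ^ 4 * c ^ 9 +
      ((-1 / 8 * A ^ 2 * B + 1 / 4 * B * K) * ρ ^ 3 * s ^ 4 +
        (-1 / 8 * A ^ 2 * B + 1 / 4 * B * K) * ρ ^ 3 * c ^ 4 * s ^ 2 +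
        (-1 / 32 * A ^ 2 * B + 1 / 16 * B * K) * ρ ^ 3 * c ^ 8 +
        (1 / 10 * A ^ 3 * B - 1 / 5 * A * B * K) * ρ ^ 4 * c ^ 5 * s ^ 2 +
        (1 / 20 * A ^ 3 * B - 1 / 10 * A * B * K) * ρ ^ 4 * c ^ 9) * parabolicAngle (ρ * c, ρ ^ 2 * s) +
      ((-7 / 1080 * A ^ 3 * B + 7 / 540 * A * B * K) * ρ ^ 4 * c * s ^ 3) * |s|)) := by
  have habs : |ρ ^ 2 * s| = ρ ^ 2 * |s| := by rw [abs_mul, abs_of_nonneg (sq_nonneg ρ)]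
  simp only [lyapunov₂, habs]
  generalize parabolicAngle _ = f
  generalize |s| = w
  simp only [evalTerms, lyapunovTerms₂, angleTerms, List.map_cons, List.map_nil, List.sum_cons,
    List.sum_nil]
  ring

/-- All weights below 10 cancel. At weight 9 the terms odd in x are not all derivatives of
polynomials; H² times the angle, with derivative xH², supplies the missing one. The x⁵ entry of
`angleTerms` completes H² towards (H - Ax⁵/5)², which keeps the angle out of weight 10. -/
theorem lyapunovDeriv₂_weighted (A B K ρ c s : ℝ) :
    lyapunovDeriv₂ A B K (ρ * c, ρ ^ 2 * s)
        (cubicField A B K (A * B / 3) (ρ * c, ρ ^ 2 * s)) =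
      ρ ^ 10 * (-7 / 135 * (A * B * (A ^ 2 - 2 * K)) *
        (c ^ 10 + c ^ 6 * s ^ 2 + c ^ 2 * s ^ 4 +
          1 / 8 * (s ^ 4 * |s| - 4 * c ^ 4 * s ^ 2 * |s|)) + ρ * (
      (-52 / 135 * A ^ 4 * B + 221 / 540 * A ^ 2 * B * K + 1 / 2 * B * K ^ 2) * c ^ 3 * s ^ 4 +
      (A ^ 4 * K - 1 / 4 * A ^ 2 * B ^ 2 - 13 / 6 * A ^ 2 * K ^ 2 + 1 / 2 * B ^ 2 * K + 1 / 2 * K ^ 3) * c ^ 5 * s ^ 3 +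
      (979 / 540 * A ^ 4 * B - 512 / 135 * A ^ 2 * B * K + 1 / 2 * B * K ^ 2) * c ^ 7 * s ^ 2 +
      (-A ^ 6 + 77 / 30 * A ^ 4 * K - 7 / 6 * A ^ 2 * K ^ 2) * c ^ 9 * s +
      (-73 / 540 * A ^ 3 * B ^ 2 + 73 / 270 * A * B ^ 2 * K) * ρ * c ^ 2 * s ^ 5 +
      (121 / 270 * A ^ 3 * B * K - 287 / 270 * A * B * K ^ 2) * ρ * c ^ 4 * s ^ 4 +
      (439 / 540 * A ^ 3 * B ^ 2 + 2 / 5 * A ^ 3 * K ^ 2 - 439 / 270 * A * B ^ 2 * K - 2 / 3 * A * K ^ 3) * ρ * c ^ 6 * s ^ 3 +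
      (-A ^ 5 * B + 707 / 270 * A ^ 3 * B * K - 343 / 270 * A * B * K ^ 2) * ρ * c ^ 8 * s ^ 2 +
      (-52 / 405 * A ^ 4 * B ^ 2 + 59 / 405 * A ^ 2 * B ^ 2 * K) * ρ ^ 2 * c ^ 3 * s ^ 5 +
      (2 / 15 * A ^ 4 * B * K - 2 / 9 * A ^ 2 * B * K ^ 2) * ρ ^ 2 * c ^ 5 * s ^ 4 +
      (7 / 405 * A ^ 4 * B ^ 2 - 14 / 405 * A ^ 2 * B ^ 2 * K) * ρ ^ 2 * c ^ 7 * s ^ 3 +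
      ((-1 / 2 * A ^ 2 * B * K + B * K ^ 2) * c * s ^ 5 +
        (-1 / 2 * A ^ 2 * B ^ 2 + B ^ 2 * K) * c ^ 3 * s ^ 4 +
        (1 / 2 * A ^ 4 * B - 5 / 4 * A ^ 2 * B * K + 1 / 2 * B * K ^ 2) * c ^ 5 * s ^ 3 +
        (-1 / 4 * A ^ 2 * B ^ 2 + 1 / 2 * B ^ 2 * K) * c ^ 7 * s ^ 2 +
        (9 / 20 * A ^ 4 * B - 9 / 10 * A ^ 2 * B * K) * c ^ 9 * s +
        (-1 / 6 * A ^ 3 * B ^ 2 + 1 / 3 * A * B ^ 2 * K) * ρ * s ^ 6 +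
        (5 / 12 * A ^ 3 * B ^ 2 - 5 / 6 * A * B ^ 2 * K) * ρ * c ^ 4 * s ^ 4 +
        (1 / 5 * A ^ 3 * B * K - 2 / 5 * A * B * K ^ 2) * ρ * c ^ 6 * s ^ 3 +
        (9 / 20 * A ^ 3 * B ^ 2 - 9 / 10 * A * B ^ 2 * K) * ρ * c ^ 8 * s ^ 2 +
        (1 / 15 * A ^ 4 * B ^ 2 - 2 / 15 * A ^ 2 * B ^ 2 * K) * ρ ^ 2 * c ^ 5 * s ^ 4) * parabolicAngle (ρ * c, ρ ^ 2 * s) +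
      ((-7 / 1080 * A ^ 4 * B + 7 / 540 * A ^ 2 * B * K) * c * s ^ 4 +
        (-7 / 1080 * A ^ 3 * B ^ 2 + 7 / 540 * A * B ^ 2 * K) * ρ * s ^ 5 +
        (-7 / 270 * A ^ 3 * B * K + 7 / 135 * A * B * K ^ 2) * ρ * c ^ 2 * s ^ 4 +
        (-7 / 810 * A ^ 4 * B ^ 2 + 7 / 405 * A ^ 2 * B ^ 2 * K) * ρ ^ 2 * c * s ^ 5) * |s|)) := by
  have habs : |ρ ^ 2 * s| = ρ ^ 2 * |s| := by rw [abs_mul, abs_of_nonneg (sq_nonneg ρ)]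
  simp only [lyapunovDeriv₂, habs]
  generalize parabolicAngle _ = f
  generalize |s| = w
  simp only [evalTerms, derivTerms, lyapunovTerms₂, angleTerms, List.map_cons, List.map_nil,
    List.sum_cons, List.sum_nil, cubicField]
  push_cast
  ring

/-- The monomials x¹⁰, x⁶y², x²y⁴ of weight 10 all vanish on x = 0, so no combination is definite.
The term x y³|y| of V contributes y⁴|y| - 4x⁴y²|y|, positive there; the weight 1/8 is small enough
to preserve positivity elsewhere. -/
theorem eq_of_isCenter_cubicField' {A B K : ℝ}
    (h : IsCenter (cubicField A B K (A * B / 3)) 0) : A * B * (A ^ 2 - 2 * K) = 0 := by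
  by_contra hne
  refine not_isCenter_of_weighted (V := lyapunov₂ A B K)
    (W := fun z => lyapunovDeriv₂ A B K z (cubicField A B K (A * B / 3) z))
    (φ := parabolicAngle) (C := Real.pi) (σ := -7 / 135 * (A * B * (A ^ 2 - 2 * K))) (n := 10)
    (P := fun p => p.1 ^ 10 + p.1 ^ 6 * p.2 ^ 2 + p.1 ^ 2 * p.2 ^ 4 +
      1 / 8 * (p.2 ^ 4 * |p.2| - 4 * p.1 ^ 4 * p.2 ^ 2 * |p.2|))
    (R := fun p =>
      (-1 / 5 * A) * p.2.1.1 ^ 5 + (1 / 3 * B) * p.1 * p.2.1.2 ^ 3 +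
      (-1 / 2 * K) * p.1 * p.2.1.1 ^ 2 * p.2.1.2 ^ 2 +
      (1 / 6 * A ^ 2 - 1 / 6 * K) * p.1 * p.2.1.1 ^ 6 +
      (-1 / 3 * A * B) * p.1 ^ 2 * p.2.1.1 * p.2.1.2 ^ 3 +
      (1 / 3 * A * K) * p.1 ^ 2 * p.2.1.1 ^ 3 * p.2.1.2 ^ 2 +
      (-1 / 7 * A ^ 3 + 5 / 21 * A * K) * p.1 ^ 2 * p.2.1.1 ^ 7 +
      (11 / 48 * A ^ 2 * B - 1 / 8 * B * K) * p.1 ^ 3 * p.2.1.1 ^ 2 * p.2.1.2 ^ 3 +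
      (-1 / 4 * A ^ 2 * K + 1 / 4 * K ^ 2) * p.1 ^ 3 * p.2.1.1 ^ 4 * p.2.1.2 ^ 2 +
      (-1 / 32 * A ^ 2 * B + 1 / 16 * B * K) * p.1 ^ 3 * p.2.1.1 ^ 6 * p.2.1.2 +
      (1 / 8 * A ^ 4 - 13 / 48 * A ^ 2 * K + 1 / 16 * K ^ 2) * p.1 ^ 3 * p.2.1.1 ^ 8 +
      (-52 / 405 * A ^ 3 * B + 59 / 405 * A * B * K) * p.1 ^ 4 * p.2.1.1 ^ 3 * p.2.1.2 ^ 3 +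
      (1 / 5 * A ^ 3 * K - 1 / 3 * A * K ^ 2) * p.1 ^ 4 * p.2.1.1 ^ 5 * p.2.1.2 ^ 2 +
      (11 / 108 * A ^ 3 * B - 11 / 54 * A * B * K) * p.1 ^ 4 * p.2.1.1 ^ 7 * p.2.1.2 +
      (-1 / 9 * A ^ 5 + 77 / 270 * A ^ 3 * K - 7 / 54 * A * K ^ 2) * p.1 ^ 4 * p.2.1.1 ^ 9 +
      ((-1 / 8 * A ^ 2 * B + 1 / 4 * B * K) * p.1 ^ 3 * p.2.1.2 ^ 4 +
        (-1 / 8 * A ^ 2 * B + 1 / 4 * B * K) * p.1 ^ 3 * p.2.1.1 ^ 4 * p.2.1.2 ^ 2 +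
        (-1 / 32 * A ^ 2 * B + 1 / 16 * B * K) * p.1 ^ 3 * p.2.1.1 ^ 8 +
        (1 / 10 * A ^ 3 * B - 1 / 5 * A * B * K) * p.1 ^ 4 * p.2.1.1 ^ 5 * p.2.1.2 ^ 2 +
        (1 / 20 * A ^ 3 * B - 1 / 10 * A * B * K) * p.1 ^ 4 * p.2.1.1 ^ 9) * p.2.2 +
      ((-7 / 1080 * A ^ 3 * B + 7 / 540 * A * B * K) * p.1 ^ 4 * p.2.1.1 * p.2.1.2 ^ 3) * |p.2.1.2|)
    (S := fun p =>
      
      (-52 / 135 * A ^ 4 * B + 221 / 540 * A ^ 2 * B * K + 1 / 2 * B * K ^ 2) * p.2.1.1 ^ 3 * p.2.1.2 ^ 4 +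
      (A ^ 4 * K - 1 / 4 * A ^ 2 * B ^ 2 - 13 / 6 * A ^ 2 * K ^ 2 + 1 / 2 * B ^ 2 * K + 1 / 2 * K ^ 3) * p.2.1.1 ^ 5 * p.2.1.2 ^ 3 +
      (979 / 540 * A ^ 4 * B - 512 / 135 * A ^ 2 * B * K + 1 / 2 * B * K ^ 2) * p.2.1.1 ^ 7 * p.2.1.2 ^ 2 +
      (-A ^ 6 + 77 / 30 * A ^ 4 * K - 7 / 6 * A ^ 2 * K ^ 2) * p.2.1.1 ^ 9 * p.2.1.2 +
      (-73 / 540 * A ^ 3 * B ^ 2 + 73 / 270 * A * B ^ 2 * K) * p.1 * p.2.1.1 ^ 2 * p.2.1.2 ^ 5 +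
      (121 / 270 * A ^ 3 * B * K - 287 / 270 * A * B * K ^ 2) * p.1 * p.2.1.1 ^ 4 * p.2.1.2 ^ 4 +
      (439 / 540 * A ^ 3 * B ^ 2 + 2 / 5 * A ^ 3 * K ^ 2 - 439 / 270 * A * B ^ 2 * K - 2 / 3 * A * K ^ 3) * p.1 * p.2.1.1 ^ 6 * p.2.1.2 ^ 3 +
      (-A ^ 5 * B + 707 / 270 * A ^ 3 * B * K - 343 / 270 * A * B * K ^ 2) * p.1 * p.2.1.1 ^ 8 * p.2.1.2 ^ 2 +
      (-52 / 405 * A ^ 4 * B ^ 2 + 59 / 405 * A ^ 2 * B ^ 2 * K) * p.1 ^ 2 * p.2.1.1 ^ 3 * p.2.1.2 ^ 5 +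
      (2 / 15 * A ^ 4 * B * K - 2 / 9 * A ^ 2 * B * K ^ 2) * p.1 ^ 2 * p.2.1.1 ^ 5 * p.2.1.2 ^ 4 +
      (7 / 405 * A ^ 4 * B ^ 2 - 14 / 405 * A ^ 2 * B ^ 2 * K) * p.1 ^ 2 * p.2.1.1 ^ 7 * p.2.1.2 ^ 3 +
      ((-1 / 2 * A ^ 2 * B * K + B * K ^ 2) * p.2.1.1 * p.2.1.2 ^ 5 +
        (-1 / 2 * A ^ 2 * B ^ 2 + B ^ 2 * K) * p.2.1.1 ^ 3 * p.2.1.2 ^ 4 +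
        (1 / 2 * A ^ 4 * B - 5 / 4 * A ^ 2 * B * K + 1 / 2 * B * K ^ 2) * p.2.1.1 ^ 5 * p.2.1.2 ^ 3 +
        (-1 / 4 * A ^ 2 * B ^ 2 + 1 / 2 * B ^ 2 * K) * p.2.1.1 ^ 7 * p.2.1.2 ^ 2 +
        (9 / 20 * A ^ 4 * B - 9 / 10 * A ^ 2 * B * K) * p.2.1.1 ^ 9 * p.2.1.2 +
        (-1 / 6 * A ^ 3 * B ^ 2 + 1 / 3 * A * B ^ 2 * K) * p.1 * p.2.1.2 ^ 6 +
        (5 / 12 * A ^ 3 * B ^ 2 - 5 / 6 * A * B ^ 2 * K) * p.1 * p.2.1.1 ^ 4 * p.2.1.2 ^ 4 +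
        (1 / 5 * A ^ 3 * B * K - 2 / 5 * A * B * K ^ 2) * p.1 * p.2.1.1 ^ 6 * p.2.1.2 ^ 3 +
        (9 / 20 * A ^ 3 * B ^ 2 - 9 / 10 * A * B ^ 2 * K) * p.1 * p.2.1.1 ^ 8 * p.2.1.2 ^ 2 +
        (1 / 15 * A ^ 4 * B ^ 2 - 2 / 15 * A ^ 2 * B ^ 2 * K) * p.1 ^ 2 * p.2.1.1 ^ 5 * p.2.1.2 ^ 4) * p.2.2 +
      ((-7 / 1080 * A ^ 4 * B + 7 / 540 * A ^ 2 * B * K) * p.2.1.1 * p.2.1.2 ^ 4 +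
        (-7 / 1080 * A ^ 3 * B ^ 2 + 7 / 540 * A * B ^ 2 * K) * p.1 * p.2.1.2 ^ 5 +
        (-7 / 270 * A ^ 3 * B * K + 7 / 135 * A * B * K ^ 2) * p.1 * p.2.1.1 ^ 2 * p.2.1.2 ^ 4 +
        (-7 / 810 * A ^ 4 * B ^ 2 + 7 / 405 * A ^ 2 * B ^ 2 * K) * p.1 ^ 2 * p.2.1.1 * p.2.1.2 ^ 5) * |p.2.1.2|)
    ?_ abs_parabolicAngle_le (by fun_prop) (by fun_prop) (by fun_prop) ?_
    (fun ρ c s _ => lyapunov₂_weighted A B K ρ c s)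
    (fun ρ c s _ => lyapunovDeriv₂_weighted A B K ρ c s)
    (fun γ t hγ h0 => hasDerivAt_lyapunov₂ A B K hγ h0) h
  · simpa using hne
  · intro c s hcs
    dsimp only
    have hs : s ^ 2 = |s| ^ 2 := (sq_abs s).symm
    have hs4 : s ^ 4 = |s| ^ 4 := by rw [show s ^ 4 = (s ^ 2) ^ 2 by ring, hs]; ring
    rw [hs, hs4]
    rw [hs] at hcs
    have hw : 0 ≤ |s| := abs_nonneg s
    generalize |s| = w at hw hcs
    have key : c ^ 10 + c ^ 6 * w ^ 2 + c ^ 2 * w ^ 4 + 1 / 8 * (w ^ 4 * w - 4 * c ^ 4 * w ^ 2 * w) =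
        c ^ 10 + w ^ 5 / 8 + 3 / 4 * (c ^ 6 * w ^ 2 + c ^ 2 * w ^ 4) +
          1 / 4 * (c ^ 2 * w ^ 2 * (c ^ 2 - w) ^ 2) := by
      ring
    rw [key]
    by_cases hc : c = 0
    · have hw' : w ≠ 0 := by
        rintro rfl
        simp [hc] at hcs
      positivity
    · positivity

/-! ### From returning polar orbits to a center. -/

/-- To have a center it suffices that all points near the singular point lie on nonconstant periodic
orbits which avoid it. -/
theorem isCenter_of_eventually_periodic {X : ℝ × ℝ → ℝ × ℝ} {p : ℝ × ℝ} (hp : X p = 0)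
    (h : ∀ᶠ q in 𝓝 p, q ≠ p → ∃ (γ : ℝ → ℝ × ℝ) (T : ℝ), γ 0 = q ∧
      (∀ t, HasDerivAt γ (X (γ t)) t) ∧ (∀ t, γ t ≠ p) ∧ 0 < T ∧ Function.Periodic γ T ∧
      ∀ s, ∃ t, γ t ≠ γ s) : IsCenter X p := by
  -- The neighborhood is the set of all points with the stated property. It is invariant because a
  -- time translate of an orbit keeps that property.
  refine ⟨hp, _, h, ?_⟩
  intro q hq hqp
  obtain ⟨γ, T, h0, hγ, hne, hT, hper, hnc⟩ := hq hqp
  refine ⟨γ, T, h0, hγ, fun t => ⟨fun _ => ?_, hne t⟩, hT, hper, ?_⟩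
  · refine ⟨fun u => γ (u + t), T, by simp, fun u => ?_, fun u => hne _, hT, fun u => ?_,
      fun s => ?_⟩
    · exact (hγ (u + t)).comp_add_const u t
    · show γ (u + T + t) = γ (u + t)
      rw [add_right_comm, hper]
    · obtain ⟨r, hr⟩ := hnc (s + t)
      exact ⟨r - t, by simpa using hr⟩
  · obtain ⟨t, ht⟩ := hnc 0
    exact ⟨t, by rwa [h0] at ht⟩

/-- A positive continuous periodic function is the reciprocal of the speed of a parametrization of
the line which is equivariant with respect to the period. -/
theorem exists_reparametrization {w : ℝ → ℝ} {P : ℝ} (hw : Continuous w) (hpos : ∀ θ, 0 < w θ)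
    (hP : 0 < P) (hper : Function.Periodic w P) (a : ℝ) :
    ∃ (Θ : ℝ → ℝ) (T : ℝ), Θ 0 = a ∧ 0 < T ∧ (∀ t, HasDerivAt Θ (w (Θ t))⁻¹ t) ∧
      (∀ t, Θ (t + T) = Θ t + P) ∧ Function.Surjective Θ := by
  -- τ is the time as a function of the angle; its inverse, shifted to start at a, is Θ, and τ P is
  -- the period.
  set τ : ℝ → ℝ := fun θ => ∫ u in (0 : ℝ)..θ, w u
  have hint : ∀ a b, IntervalIntegrable w MeasureTheory.volume a b := fun a b =>
    hw.intervalIntegrable a b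
  have hτ : ∀ θ, HasDerivAt τ (w θ) θ := fun θ => hw.integral_hasStrictDerivAt 0 θ |>.hasDerivAt
  have hmono : StrictMono τ := strictMono_of_deriv_pos fun θ => by
    rw [(hτ θ).deriv]
    exact hpos θ
  have hcont : Continuous τ := continuous_iff_continuousAt.2 fun θ => (hτ θ).continuousAt
  have hsurj : Function.Surjective τ := hcont.surjective
    (hper.tendsto_atTop_intervalIntegral_of_pos' (hint 0 P) hpos hP)
    (hper.tendsto_atBot_intervalIntegral_of_pos' (hint 0 P) hpos hP)
  set e : ℝ ≃o ℝ := hmono.orderIsoOfSurjective τ hsurj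
  have he : ∀ θ, e θ = τ θ := fun θ => rfl
  have hτP : ∀ θ, τ (θ + P) = τ θ + τ P := by
    intro θ
    have h1 := hper.intervalIntegral_add_eq θ 0
    have h2 := intervalIntegral.integral_add_adjacent_intervals (hint 0 θ) (hint θ (θ + P))
    rw [h1, zero_add] at h2
    exact h2.symm
  have hesymm : ∀ t, HasDerivAt e.symm (w (e.symm t))⁻¹ t := fun t =>
    HasDerivAt.of_local_left_inverse e.symm.continuous.continuousAt (hτ _) (hpos _).ne'
      (Filter.Eventually.of_forall fun y => e.apply_symm_apply y)
  have hTpos : 0 < τ P := by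
    have := hmono hP
    rwa [show τ 0 = 0 from intervalIntegral.integral_same] at this
  refine ⟨fun t => e.symm (t + τ a), τ P, ?_, hTpos, fun t => ?_, fun t => ?_, fun θ => ?_⟩
  · simp only [zero_add]
    rw [← he, e.symm_apply_apply]
  · exact (hesymm (t + τ a)).comp_add_const t (τ a)
  · simp only
    rw [e.symm_apply_eq, he, hτP, ← he (e.symm _), e.apply_symm_apply]
    ring
  · exact ⟨e θ - τ a, by simp⟩

/-- The radial speed of the system in weighted polar coordinates, up to a positive factor. -/
def radialPart (A B K L ρ c s : ℝ) : ℝ :=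
  c * (s + ρ * A * c * s + ρ ^ 2 * B * s ^ 2) +
    s * (-c ^ 3 + ρ ^ 2 * K * c * s ^ 2 + ρ ^ 3 * L * s ^ 3)

/-- The angular speed of the system in weighted polar coordinates, up to a positive factor. -/
def angularPart (A B K L ρ c s : ℝ) : ℝ :=
  c * (-c ^ 3 + ρ ^ 2 * K * c * s ^ 2 + ρ ^ 3 * L * s ^ 3) -
    2 * s * (s + ρ * A * c * s + ρ ^ 2 * B * s ^ 2)

/-- The equation of the orbits in weighted polar coordinates `x = exp r * cos θ`,
`y = exp (2 * r) * sin θ`, truncated at `r = r₀`. -/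
noncomputable def orbitField (A B K L r₀ θ r : ℝ) : ℝ :=
  radialPart A B K L (Real.exp (min r r₀)) (Real.cos θ) (Real.sin θ) /
    angularPart A B K L (Real.exp (min r r₀)) (Real.cos θ) (Real.sin θ)

theorem abs_exp_min_sub_le (r₀ a b : ℝ) :
    |Real.exp (min a r₀) - Real.exp (min b r₀)| ≤ Real.exp r₀ * |a - b| := by
  have h1 := (convex_Iic r₀).norm_image_sub_le_of_norm_deriv_le (f := Real.exp)
    (C := Real.exp r₀) (fun x _ => Real.differentiableAt_exp)
    (fun x hx => by
      rw [Real.deriv_exp, Real.norm_eq_abs, Real.abs_exp]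
      exact Real.exp_le_exp.2 hx) (min_le_right b r₀) (min_le_right a r₀)
  refine h1.trans ?_
  gcongr
  simpa using abs_min_sub_min_le_max a r₀ b r₀

/-- At ρ = 0 the angular part is -(c⁴ + 2s²) < 0, so by compactness it stays negative for small ρ.
The quotient is then C¹ near a compact set, hence Lipschitz and bounded on it. -/
theorem exists_orbitField_bounds (A B K L : ℝ) : ∃ (r₀ : ℝ) (C : NNReal) (M : ℝ),
    (∀ ρ ∈ Set.Icc 0 (Real.exp r₀), ∀ c s : ℝ, c ^ 2 + s ^ 2 = 1 →
      angularPart A B K L ρ c s < 0) ∧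
    (∀ θ, LipschitzWith C (orbitField A B K L r₀ θ)) ∧ ∀ θ r, |orbitField A B K L r₀ θ r| ≤ M := by
  obtain ⟨ρ₀, hρ₀, hneg⟩ := isCompact_unitCircle.exists_forall_abs_le_pos
    (G := fun p => -angularPart A B K L p.1 p.2.1 p.2.2)
    (by unfold angularPart; fun_prop) (by
      rintro ⟨c, s⟩ h
      simp only [Set.mem_ofPred_eq] at h
      have h' : s ^ 2 = 1 - c ^ 2 := by linarith
      have : -angularPart A B K L 0 c s = c ^ 4 + 2 * s ^ 2 := by
        unfold angularPart
        ring
      dsimp only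
      rw [this, h']
      nlinarith [sq_nonneg (c ^ 2 - 1)])
  set S := Set.Icc 0 ρ₀ ×ˢ {p : ℝ × ℝ | p.1 ^ 2 + p.2 ^ 2 = 1}
  have hS : IsCompact S := isCompact_Icc.prod isCompact_unitCircle
  have hD : ∀ ρ ∈ Set.Icc 0 ρ₀, ∀ c s : ℝ, c ^ 2 + s ^ 2 = 1 →
      angularPart A B K L ρ c s < 0 := by
    intro ρ hρ c s h
    have := hneg ρ (by rw [abs_of_nonneg hρ.1]; exact hρ.2) (c, s) h
    dsimp only at this
    linarith
  set F : ℝ × ℝ × ℝ → ℝ := fun p =>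
    radialPart A B K L p.1 p.2.1 p.2.2 / angularPart A B K L p.1 p.2.1 p.2.2
  have hF : ∀ p ∈ S, ContDiffAt ℝ 1 F p := by
    rintro ⟨ρ, c, s⟩ ⟨h1, h2⟩
    refine ContDiffAt.div ?_ ?_ (hD ρ h1 c s h2).ne
    · unfold radialPart
      fun_prop
    · unfold angularPart
      fun_prop
  obtain ⟨C, hC⟩ := LocallyLipschitzOn.exists_lipschitzOnWith_of_compact hS (f := F) (by
    intro p hp
    obtain ⟨C, t, ht, h⟩ := (hF p hp).exists_lipschitzOnWith
    exact ⟨C, t, mem_nhdsWithin_of_mem_nhds ht, h⟩)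
  obtain ⟨M, hM⟩ := hS.exists_bound_of_continuousOn (f := F) fun p hp =>
    (hF p hp).continuousAt.continuousWithinAt
  have hexp : Real.exp (Real.log ρ₀) = ρ₀ := Real.exp_log hρ₀
  have hmem : ∀ θ r, (Real.exp (min r (Real.log ρ₀)), Real.cos θ, Real.sin θ) ∈ S := by
    intro θ r
    refine ⟨⟨(Real.exp_pos _).le, ?_⟩, Real.cos_sq_add_sin_sq θ⟩
    rw [← hexp]
    simp
  refine ⟨Real.log ρ₀, C * ρ₀.toNNReal, M, ?_, fun θ => ?_, fun θ r => hM _ (hmem θ r)⟩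
  · rwa [hexp]
  · refine LipschitzWith.of_dist_le_mul fun a b => ?_
    refine (hC.dist_le_mul _ (hmem θ a) _ (hmem θ b)).trans ?_
    rw [Prod.dist_eq, dist_self, max_eq_left dist_nonneg, Real.dist_eq, Real.dist_eq,
      NNReal.coe_mul, Real.coe_toNNReal _ hρ₀.le, mul_assoc]
    have := abs_exp_min_sub_le (Real.log ρ₀) a b
    rw [hexp] at this
    exact mul_le_mul_of_nonneg_left this C.2

theorem continuous_orbitField {A B K L r₀ : ℝ}
    (hD : ∀ ρ ∈ Set.Icc 0 (Real.exp r₀), ∀ c s : ℝ, c ^ 2 + s ^ 2 = 1 →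
      angularPart A B K L ρ c s < 0) (r : ℝ) :
    Continuous fun θ => orbitField A B K L r₀ θ r := by
  unfold orbitField
  refine Continuous.div (by unfold radialPart; fun_prop) (by unfold angularPart; fun_prop)
    fun θ => (hD _ ⟨(Real.exp_pos _).le, ?_⟩ _ _ (Real.cos_sq_add_sin_sq θ)).ne
  simp

/-- The curve with equation `r = α θ` in weighted polar coordinates. -/
noncomputable def polarCurve (α : ℝ → ℝ) (θ : ℝ) : ℝ × ℝ :=
  (Real.exp (α θ) * Real.cos θ, Real.exp (α θ) ^ 2 * Real.sin θ)

/-- The scalar factor is dt/dθ; 1 + sin² = cos² + 2 sin² comes from the Jacobian of the weighted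
coordinates. -/
theorem hasDerivAt_polarCurve {A B K L r₀ : ℝ} {α : ℝ → ℝ} {θ : ℝ}
    (hα : HasDerivAt α (orbitField A B K L r₀ θ (α θ)) θ) (hle : α θ ≤ r₀)
    (hD : angularPart A B K L (Real.exp (α θ)) (Real.cos θ) (Real.sin θ) ≠ 0) :
    HasDerivAt (polarCurve α) (((1 + Real.sin θ ^ 2) /
      (Real.exp (α θ) * angularPart A B K L (Real.exp (α θ)) (Real.cos θ) (Real.sin θ))) •
        cubicField A B K L (polarCurve α θ)) θ := by
  rw [orbitField, min_eq_left hle] at hα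
  have h1 := hα.exp.mul (Real.hasDerivAt_cos θ)
  have h2 := (hα.exp.pow 2).mul (Real.hasDerivAt_sin θ)
  refine (h1.prodMk h2).congr_deriv ?_
  have hcs := Real.cos_sq_add_sin_sq θ
  have he := (Real.exp_pos (α θ)).ne'
  simp only [polarCurve, cubicField, Prod.smul_mk, smul_eq_mul, Pi.pow_apply]
  set ρ := Real.exp (α θ)
  set c := Real.cos θ
  set s := Real.sin θ
  rw [show 1 + s ^ 2 = c ^ 2 + 2 * s ^ 2 by linarith]
  ext
  · dsimp only
    field_simp
    unfold radialPart angularPart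
    ring
  · dsimp only
    field_simp
    unfold radialPart angularPart
    push_cast
    ring

/-- If the orbits near the origin close up after one turn, then the origin is a center. -/
theorem isCenter_cubicField_of_return {A B K L r₀ M : ℝ} {C : NNReal}
    (hD : ∀ ρ ∈ Set.Icc 0 (Real.exp r₀), ∀ c s : ℝ, c ^ 2 + s ^ 2 = 1 →
      angularPart A B K L ρ c s < 0)
    (hC : ∀ θ, LipschitzWith C (orbitField A B K L r₀ θ))
    (hM : ∀ θ r, |orbitField A B K L r₀ θ r| ≤ M)
    (hret : ∀ α : ℝ → ℝ, (∀ θ, HasDerivAt α (orbitField A B K L r₀ θ (α θ)) θ) → ∀ a,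
      (∀ θ ∈ Set.Icc a (a + 2 * Real.pi), α θ ≤ r₀) → α (a + 2 * Real.pi) = α a) :
    IsCenter (cubicField A B K L) 0 := by
  have hM0 : 0 ≤ M := (abs_nonneg _).trans (hM 0 0)
  have hπ := Real.pi_pos
  refine isCenter_of_eventually_periodic (by simp [cubicField]) ?_
  -- As |dr/dθ| ≤ M, starting below r₀ - 2πM keeps r ≤ r₀ for a full turn, where the truncation is
  -- inactive.
  set r₁ := Real.exp (r₀ - M * (2 * Real.pi))
  have hr₁ : 0 < r₁ := Real.exp_pos _
  have hsmall : ∀ᶠ z in 𝓝 (0 : ℝ × ℝ), z.1 ^ 4 + z.2 ^ 2 < r₁ ^ 4 / 2 := by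
    have : Continuous fun z : ℝ × ℝ => z.1 ^ 4 + z.2 ^ 2 := by fun_prop
    refine this.continuousAt.eventually (gt_mem_nhds ?_)
    simp
    positivity
  filter_upwards [hsmall] with q hq hq0
  obtain ⟨ρ, a, hρ, rfl⟩ := exists_weighted_polar_angle hq0
  have hρle := weighted_radius_le hr₁ (Real.cos_sq_add_sin_sq a) hq.le
  obtain ⟨α, hαa, hα⟩ := exists_forall_hasDerivAt_of_lipschitz_of_bounded hC
    (continuous_orbitField hD) hM a (Real.log ρ)
  have hαc : Continuous α := continuous_iff_continuousAt.2 fun θ => (hα θ).continuousAt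
  have hlog : Real.log ρ ≤ r₀ - M * (2 * Real.pi) := (Real.log_le_iff_le_exp hρ).2 hρle
  have hle : ∀ θ ∈ Set.Icc a (a + 2 * Real.pi), α θ ≤ r₀ := by
    intro θ hθ
    have h1 := convex_univ.norm_image_sub_le_of_norm_hasDerivWithin_le (C := M)
      (fun x _ => (hα x).hasDerivWithinAt) (fun x _ => hM _ _) (Set.mem_univ a) (Set.mem_univ θ)
    rw [Real.norm_eq_abs, Real.norm_eq_abs, abs_of_nonneg (by linarith [hθ.1] : 0 ≤ θ - a)] at h1
    have h2 : M * (θ - a) ≤ M * (2 * Real.pi) := by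
      gcongr
      linarith [hθ.2]
    linarith [le_abs_self (α θ - α a)]
  have hper : Function.Periodic α (2 * Real.pi) :=
    periodic_of_hasDerivAt_of_eq hC (fun θ r => by simp [orbitField]) hα (hret α hα a hle)
  have hle' : ∀ θ, α θ ≤ r₀ := by
    intro θ
    obtain ⟨θ', hθ', h⟩ := hper.exists_mem_Ico (by positivity) θ a
    rw [h]
    exact hle θ' ⟨hθ'.1, hθ'.2.le⟩
  have hDneg : ∀ θ, angularPart A B K L (Real.exp (α θ)) (Real.cos θ) (Real.sin θ) < 0 :=
    fun θ => hD _ ⟨(Real.exp_pos _).le, Real.exp_le_exp.2 (hle' θ)⟩ _ _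
      (Real.cos_sq_add_sin_sq θ)
  set w : ℝ → ℝ := fun θ => -((1 + Real.sin θ ^ 2) /
      (Real.exp (α θ) * angularPart A B K L (Real.exp (α θ)) (Real.cos θ) (Real.sin θ)))
  have hw : Continuous w := by
    refine (Continuous.div (by fun_prop) (by unfold angularPart; fun_prop) fun θ => ?_).neg
    exact mul_ne_zero (Real.exp_pos _).ne' (hDneg θ).ne
  have hwpos : ∀ θ, 0 < w θ := fun θ =>
    neg_pos.2 (div_neg_of_pos_of_neg (by positivity)
      (mul_neg_of_pos_of_neg (Real.exp_pos _) (hDneg θ)))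
  have hwper : Function.Periodic w (2 * Real.pi) := fun θ => by
    simp only [w, hper θ, Real.sin_add_two_pi, Real.cos_add_two_pi]
  obtain ⟨Θ, T, hΘ0, hT, hΘ, hΘT, hΘs⟩ :=
    exists_reparametrization hw hwpos (by positivity) hwper a
  have hcurve : Function.Periodic (polarCurve α) (2 * Real.pi) := fun θ => by
    simp only [polarCurve, hper θ, Real.sin_add_two_pi, Real.cos_add_two_pi]
  -- The angle decreases in time, whereas Θ increases; hence the argument -t.
  refine ⟨fun t => polarCurve α (Θ (-t)), T, ?_, fun t => ?_, fun t => ?_, hT, fun t => ?_,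
    fun t => ?_⟩
  · simp only [neg_zero, hΘ0, polarCurve, hαa, Real.exp_log hρ]
  · have h1 : HasDerivAt (fun u => Θ (-u)) (-(w (Θ (-t)))⁻¹) t := by
      have := (hΘ (0 - t)).comp_const_sub 0 t
      simpa using this
    have h2 := (hasDerivAt_polarCurve (hα (Θ (-t))) (hle' _) (hDneg _).ne).scomp t h1
    refine h2.congr_deriv ?_
    rw [smul_smul, ← inv_neg]
    simp only [w, neg_neg]
    rw [inv_mul_cancel₀, one_smul]
    exact div_ne_zero (by positivity) (mul_ne_zero (Real.exp_pos _).ne' (hDneg _).ne)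
  · exact weighted_polar_ne_zero (Real.exp_pos _) (Real.cos_sq_add_sin_sq _)
  · have := hΘT (-(t + T))
    rw [show -(t + T) + T = -t by ring] at this
    simp only
    rw [this, hcurve]
  -- Half a turn later the point is different, since sine and cosine never vanish together.
  · obtain ⟨u, hu⟩ := hΘs (Θ (-t) + Real.pi)
    refine ⟨-u, fun h => ?_⟩
    simp only [neg_neg, hu, polarCurve, Real.cos_add_pi, Real.sin_add_pi, Prod.mk.injEq] at h
    have e1 := Real.exp_pos (α (Θ (-t)))
    have e2 := Real.exp_pos (α (Θ (-t) + Real.pi))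
    have hc : (Real.exp (α (Θ (-t))) + Real.exp (α (Θ (-t) + Real.pi))) * Real.cos (Θ (-t)) = 0 := by
      linarith [h.1]
    have hs : (Real.exp (α (Θ (-t))) ^ 2 + Real.exp (α (Θ (-t) + Real.pi)) ^ 2) *
        Real.sin (Θ (-t)) = 0 := by
      linarith [h.2]
    have hc' := (mul_eq_zero.1 hc).resolve_left (by positivity)
    have hs' := (mul_eq_zero.1 hs).resolve_left (by positivity)
    have := Real.cos_sq_add_sin_sq (Θ (-t))
    simp [hc', hs'] at this

/-! ### The three families of centers. -/

theorem isCenter_cubicField_of_reflect {A B K L a : ℝ}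
    (h : ∀ r₀ θ r, orbitField A B K L r₀ (2 * a - θ) r = -orbitField A B K L r₀ θ r) :
    IsCenter (cubicField A B K L) 0 := by
  obtain ⟨r₀, C, M, hD, hC, hM⟩ := exists_orbitField_bounds A B K L
  exact isCenter_cubicField_of_return hD hC hM fun α hα b _ =>
    periodic_of_hasDerivAt_of_reflect hC (fun θ r => by simp [orbitField]) (h r₀) hα b

/-- The symmetry (y, t) → (-y, -t) is θ → -θ. -/
theorem isCenter_cubicField_of_reversible_left (A K : ℝ) : IsCenter (cubicField A 0 K 0) 0 := by
  refine isCenter_cubicField_of_reflect (a := 0) fun r₀ θ r => ?_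
  rw [mul_zero, zero_sub, orbitField, orbitField, Real.cos_neg, Real.sin_neg, ← neg_div]
  congr 1 <;> · simp only [radialPart, angularPart]; ring

/-- The symmetry (x, t) → (-x, -t) is θ → π - θ. -/
theorem isCenter_cubicField_of_reversible_right (B K : ℝ) : IsCenter (cubicField 0 B K 0) 0 := by
  refine isCenter_cubicField_of_reflect (a := Real.pi / 2) fun r₀ θ r => ?_
  rw [show 2 * (Real.pi / 2) - θ = Real.pi - θ by ring, orbitField, orbitField, Real.cos_pi_sub,
    Real.sin_pi_sub, ← neg_div]
  congr 1 <;> · simp only [radialPart, angularPart]; ring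

/-- The first integral of the system when `exp (-A x)` is an integrating factor. -/
noncomputable def firstIntegral (A B : ℝ) (z : ℝ × ℝ) : ℝ :=
  Real.exp (-A * z.1) * (z.2 ^ 2 / 2 * (1 + A * z.1) + B * z.2 ^ 3 / 3) +
    ∫ u in (0 : ℝ)..z.1, u ^ 3 * Real.exp (-A * u)

/-- The form e^(-Ax)(ẋ dy - ẏ dx) is closed exactly because K = A²/2 and L = AB/3; it vanishes along
orbits. -/
theorem hasDerivAt_firstIntegral (A B : ℝ) {x y : ℝ → ℝ} {x' y' t : ℝ}
    (hx : HasDerivAt x x' t) (hy : HasDerivAt y y' t) :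
    HasDerivAt (fun u => firstIntegral A B (x u, y u)) (Real.exp (-A * x t) *
      ((cubicField A B (A ^ 2 / 2) (A * B / 3) (x t, y t)).1 * y' -
        (cubicField A B (A ^ 2 / 2) (A * B / 3) (x t, y t)).2 * x')) t := by
  have hc : Continuous fun u : ℝ => u ^ 3 * Real.exp (-A * u) := by fun_prop
  have h1 := HasDerivAt.comp t (hc.integral_hasStrictDerivAt 0 (x t)).hasDerivAt hx
  have h2 := (hx.const_mul (-A)).exp
  have h3 := (((hy.pow 2).div_const 2).mul ((hx.const_mul A).const_add 1)).add
    (((hy.pow 3).const_mul B).div_const 3)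
  refine ((h2.mul h3).add h1).congr_deriv ?_
  simp only [cubicField, Pi.add_apply, Pi.mul_apply, Pi.pow_apply]
  push_cast
  ring

theorem isCenter_cubicField_of_integrable (A B : ℝ) :
    IsCenter (cubicField A B (A ^ 2 / 2) (A * B / 3)) 0 := by
  obtain ⟨r₀, C, M, hD, hC, hM⟩ := exists_orbitField_bounds A B (A ^ 2 / 2) (A * B / 3)
  refine isCenter_cubicField_of_return hD hC hM fun α hα a hle => ?_
  have hπ := Real.pi_pos
  have hD' : ∀ θ ∈ Set.Icc a (a + 2 * Real.pi), angularPart A B (A ^ 2 / 2) (A * B / 3)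
      (Real.exp (α θ)) (Real.cos θ) (Real.sin θ) ≠ 0 := fun θ hθ =>
    (hD _ ⟨(Real.exp_pos _).le, Real.exp_le_exp.2 (hle θ hθ)⟩ _ _ (Real.cos_sq_add_sin_sq θ)).ne
  have hderiv : ∀ θ ∈ Set.Icc a (a + 2 * Real.pi),
      HasDerivAt (fun u => firstIntegral A B (polarCurve α u)) 0 θ := by
    intro θ hθ
    have h1 := hasDerivAt_polarCurve (hα θ) (hle θ hθ) (hD' θ hθ)
    have hx := (ContinuousLinearMap.fst ℝ ℝ ℝ).hasFDerivAt.comp_hasDerivAt θ h1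
    have hy := (ContinuousLinearMap.snd ℝ ℝ ℝ).hasFDerivAt.comp_hasDerivAt θ h1
    refine (hasDerivAt_firstIntegral A B hx hy).congr_deriv ?_
    simp only [Function.comp_apply, ContinuousLinearMap.coe_fst', ContinuousLinearMap.coe_snd',
      Prod.smul_fst, Prod.smul_snd, smul_eq_mul, Prod.mk.eta]
    ring
  have hconst := constant_of_has_deriv_right_zero
    (fun θ hθ => (hderiv θ hθ).continuousAt.continuousWithinAt)
    (fun θ hθ => (hderiv θ (Set.Ico_subset_Icc_self hθ)).hasDerivWithinAt) (a + 2 * Real.pi)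
    (Set.right_mem_Icc.2 (by linarith))
  simp only [polarCurve, Real.cos_add_two_pi, Real.sin_add_two_pi] at hconst
  set c := Real.cos a
  set s := Real.sin a
  -- Along a fixed direction (c, s) the first integral has derivative of sign opposite to the
  -- angular part, hence is strictly increasing. Equal values one turn apart therefore force equal
  -- radii.
  have hrad : ∀ ρ : ℝ, HasDerivAt (fun u : ℝ => firstIntegral A B (u * c, u ^ 2 * s))
      (-(Real.exp (-A * (ρ * c)) * ρ ^ 3 *
        angularPart A B (A ^ 2 / 2) (A * B / 3) ρ c s)) ρ := by
    intro ρ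
    refine (hasDerivAt_firstIntegral A B ((hasDerivAt_id ρ).mul_const c)
      ((hasDerivAt_pow 2 ρ).mul_const s)).congr_deriv ?_
    simp only [cubicField, angularPart, id]
    push_cast
    ring
  have hmono : StrictMonoOn (fun u : ℝ => firstIntegral A B (u * c, u ^ 2 * s))
      (Set.Icc 0 (Real.exp r₀)) := by
    refine strictMonoOn_of_deriv_pos (convex_Icc _ _)
      (fun ρ _ => (hrad ρ).continuousAt.continuousWithinAt) fun ρ hρ => ?_
    rw [interior_Icc] at hρ
    rw [(hrad ρ).deriv, ← mul_neg]
    have h1 := hD ρ (Set.Ioo_subset_Icc_self hρ) c s (Real.cos_sq_add_sin_sq a)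
    have h2 : 0 < ρ ^ 3 := pow_pos hρ.1 3
    exact mul_pos (mul_pos (Real.exp_pos _) h2) (neg_pos.2 h1)
  have hmem : ∀ θ ∈ Set.Icc a (a + 2 * Real.pi), Real.exp (α θ) ∈ Set.Icc 0 (Real.exp r₀) :=
    fun θ hθ => ⟨(Real.exp_pos _).le, Real.exp_le_exp.2 (hle θ hθ)⟩
  exact Real.exp_injective (hmono.injOn
    (hmem _ (Set.right_mem_Icc.2 (by linarith))) (hmem _ (Set.left_mem_Icc.2 (by linarith))) hconst)

theorem isCenter_cubicField {A B K L : ℝ} (h₁ : A * B - 3 * L = 0)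
    (h₂ : A * B * (A ^ 2 - 2 * K) = 0) : IsCenter (cubicField A B K L) 0 := by
  obtain rfl : L = A * B / 3 := by linarith
  rcases mul_eq_zero.1 h₂ with h | h
  · rcases mul_eq_zero.1 h with rfl | rfl
    · simpa using isCenter_cubicField_of_reversible_right B K
    · simpa using isCenter_cubicField_of_reversible_left A K
  · obtain rfl : K = A ^ 2 / 2 := by linarith
    exact isCenter_cubicField_of_integrable A B

/-! ### Nilpotent form and conclusion. -/

theorem hasNilpotentForm_cubicField (A B K L : ℝ) : HasNilpotentForm (cubicField A B K L) 0 := by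
  have hfst : AnalyticAt ℝ (fun u : ℝ × ℝ => u.1) 0 := analyticAt_fst
  have hsnd : AnalyticAt ℝ (fun u : ℝ × ℝ => u.2) 0 := analyticAt_snd
  refine ⟨AffineEquiv.refl ℝ _, 1, fun u => A * u.1 * u.2 + B * u.2 ^ 2,
    fun u => -u.1 ^ 3 + K * u.1 * u.2 ^ 2 + L * u.2 ^ 3, by simp, one_ne_zero, ?_, by simp, ?_,
    ?_, by simp, ?_, Filter.Eventually.of_forall fun u => ?_⟩
  · fun_prop
  · have h1 : HasFDerivAt (fun u : ℝ × ℝ => u.1) (ContinuousLinearMap.fst ℝ ℝ ℝ) 0 :=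
      hasFDerivAt_fst
    have h2 : HasFDerivAt (fun u : ℝ × ℝ => u.2) (ContinuousLinearMap.snd ℝ ℝ ℝ) 0 :=
      hasFDerivAt_snd
    refine (((h1.const_mul A).mul h2).add ((h2.pow 2).const_mul B)).fderiv.trans ?_
    simp
  · fun_prop
  · have h1 : HasFDerivAt (fun u : ℝ × ℝ => u.1) (ContinuousLinearMap.fst ℝ ℝ ℝ) 0 :=
      hasFDerivAt_fst
    have h2 : HasFDerivAt (fun u : ℝ × ℝ => u.2) (ContinuousLinearMap.snd ℝ ℝ ℝ) 0 :=
      hasFDerivAt_snd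
    refine ((((h1.pow 3).neg).add ((h1.const_mul K).mul (h2.pow 2))).add
      ((h2.pow 3).const_mul L)).fderiv.trans ?_
    simp
  · simp [cubicField, add_assoc]

theorem mainTheorem6 (A B K L : ℝ) :
    IsNilpotentCenter (cubicField A B K L) (0, 0) ↔
      A * B - 3 * L = 0 ∧ A * B * (A ^ 2 - 2 * K) = 0 := by
  constructor
  · rintro ⟨h, -⟩
    have h₁ := eq_of_isCenter_cubicField h
    refine ⟨h₁, ?_⟩
    obtain rfl : L = A * B / 3 := by linarith
    exact eq_of_isCenter_cubicField' h
  · rintro ⟨h₁, h₂⟩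
    exact ⟨isCenter_cubicField h₁ h₂, hasNilpotentForm_cubicField A B K L⟩
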